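/- Let $(M,\Pi)$ be a Poisson manifold (smooth, finite-dimensional, Hausdorff, second countable) with bracket $\{f,g\}_M=\Pi(\mathrm{d}f,\mathrm{d}g)$. Let $\iota:S\hookrightarrow M$ be an embedded Poisson submanifold, i.e. $\Pi_q\in\wedge^2T_qS$ for all $q\in S$, with induced bracket $\{\cdot,\cdot\}_S$ on $C^\infty(S)$. Let $\pi:E=T_SM/TS\to S$ be its normal bundle, $\nu:T_SM\to E$ the quotient projection, and let $$C^\infty_{\mathrm{aff}}(E)=\{\pi^*f+\ell_\eta\}\simeq C^\infty(S)\oplus\Gamma(E^*),\qquad \ell_\eta(z)=\langle\eta_{\pi(z)},z\rangle,$$ be the commutative algebra of fiberwise affine functions with product $(f_1\oplus\eta_1)\cdot(f_2\oplus\eta_2)=f_1f_2\oplus(f_1\eta_2+f_2\eta_1)$. The cotangent Lie algebroid bracket on one-forms of $M$, $[\alpha,\beta]_A=\mathbf{i}_{\Pi^\natural\alpha}\mathrm{d}\beta-\mathbf{i}_{\Pi^\natural\beta}\mathrm{d}\alpha-\mathrm{d}\langle\alpha,\Pi^\natural\beta\rangle$ with $\Pi^\natural\alpha=\mathbf{i}_\alpha\Pi$,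 restricts to sections of $T^*_SM$, and through $\nu^*:E^*\cong TS^\circ\subset T^*_SM$ it induces a bracket $[\cdot,\cdot]_{E^*}$ on $\Gamma(E^*)$. An *infinitesimal Poisson algebra* is a Poisson algebra $(C^\infty_{\mathrm{aff}}(E),\cdot,\{\cdot,\cdot\}^{\mathrm{aff}})$ with the above product such that (a) the projection $f\oplus\eta\mapsto f$ onto $(C^\infty(S),\cdot,\{\cdot,\cdot\}_S)$ is a homomorphism of Poisson algebras, and (b) $\{0\oplus\eta_1,0\oplus\eta_2\}^{\mathrm{aff}}=0\oplus[\eta_1,\eta_2]_{E^*}$ for all $\eta_1,\eta_2\in\Gamma(E^*)$. An *exponential map* is a diffeomorphism $\mathbf{e}$ from $E$ onto an open neighborhood of $S$ in $M$ with $\mathbf{e}(0_q)=\iota(q)$, such that for every $q\in S$ the composition $E_q\hookrightarrow T_{0_q}E\xrightarrow{\mathrm{d}\mathbf{e}}T_{\iota(q)}M\xrightarrow{\nu_q}E_q$ is the identity. The linearization map $\mathrm{Aff}:C^\infty(E)\to C^\infty_{\mathrm{aff}}(E)$ sends $F$ to $f\oplus\eta$, where $f(q)=F(0_q)$ and $\eta_q=\mathrm{d}_{0_q}F|_{E_q}$.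 Write $O_2$ for any smooth function on $E$ which vanishes together with its differential at all points of the zero section. **Theorem.** Let $S\subset M$ be an embedded Poisson submanifold and $\mathbf{e}:E\to M$ an exponential map. Then there exists an infinitesimal Poisson algebra $(C^\infty_{\mathrm{aff}}(E),\cdot,\{\cdot,\cdot\}^{\mathrm{aff}})$ such that $$\{\phi_1\circ\mathbf{e}^{-1},\phi_2\circ\mathbf{e}^{-1}\}_M\circ\mathbf{e}=\{\phi_1,\phi_2\}^{\mathrm{aff}}+O_2\qquad\text{for all }\phi_1,\phi_2\in C^\infty_{\mathrm{aff}}(E).\tag{$*$}$$ Moreover, an infinitesimal Poisson algebra satisfies $(*)$ if and only if $\mathrm{Aff}\circ\mathbf{e}^*:C^\infty(M)\to C^\infty_{\mathrm{aff}}(E)$ is a homomorphism of Poisson algebras. -/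

import Mathlib

open Set Filter Topology Bundle Manifold
open scoped Manifold ContDiff

set_option linter.unusedSectionVars false

/-- An embedded smooth `k`-dimensional submanifold `ι : S ↪ M` of an `m`-dimensional manifold. -/
structure EmbeddedSubmanifold (k m : ℕ) (S M : Type*)
    [TopologicalSpace S] [ChartedSpace (EuclideanSpace ℝ (Fin k)) S]
    [TopologicalSpace M] [ChartedSpace (EuclideanSpace ℝ (Fin m)) M] where
  incl : S → M
  isSmoothEmbedding : IsSmoothEmbedding (𝓡 k) (𝓡 m) ∞ incl

namespace EmbeddedSubmanifold

variable {k m : ℕ} {S M : Type*}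
  [TopologicalSpace S] [ChartedSpace (EuclideanSpace ℝ (Fin k)) S]
  [TopologicalSpace M] [ChartedSpace (EuclideanSpace ℝ (Fin m)) M]

/-- The differential `d_qι : T_qS → T_{ι q}M` of the inclusion. -/
noncomputable def diff (i : EmbeddedSubmanifold k m S M) (q : S) :
    TangentSpace (𝓡 k) q →L[ℝ] TangentSpace (𝓡 m) (i.incl q) :=
  mfderiv (𝓡 k) (𝓡 m) i.incl q

/-- The subspace `T_qS ⊆ T_{ι q}M`. -/
noncomputable def tangent (i : EmbeddedSubmanifold k m S M) (q : S) :
    Submodule ℝ (TangentSpace (𝓡 m) (i.incl q)) :=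
  LinearMap.range (i.diff q).toLinearMap

theorem contMDiff (i : EmbeddedSubmanifold k m S M) :
    ContMDiff (𝓡 k) (𝓡 m) ∞ i.incl := i.isSmoothEmbedding.contMDiff

/-- The fiber `E_q = T_{ι q}M / T_qS` of the normal bundle. -/
def Normal (i : EmbeddedSubmanifold k m S M) (q : S) : Type :=
  TangentSpace (𝓡 m) (i.incl q) ⧸ i.tangent q

section
variable (i : EmbeddedSubmanifold k m S M) (q : S)

noncomputable instance : AddCommGroup (i.Normal q) :=
  inferInstanceAs (AddCommGroup (TangentSpace (𝓡 m) (i.incl q) ⧸ i.tangent q))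
noncomputable instance : Module ℝ (i.Normal q) :=
  inferInstanceAs (Module ℝ (TangentSpace (𝓡 m) (i.incl q) ⧸ i.tangent q))
noncomputable instance : TopologicalSpace (i.Normal q) :=
  inferInstanceAs (TopologicalSpace (TangentSpace (𝓡 m) (i.incl q) ⧸ i.tangent q))
instance : IsTopologicalAddGroup (i.Normal q) :=
  inferInstanceAs (IsTopologicalAddGroup (TangentSpace (𝓡 m) (i.incl q) ⧸ i.tangent q))
instance : ContinuousSMul ℝ (i.Normal q) :=
  inferInstanceAs (ContinuousSMul ℝ (TangentSpace (𝓡 m) (i.incl q) ⧸ i.tangent q))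
end

/-- The quotient projection `ν_q : T_{ι q}M → E_q`. -/
noncomputable def nu (i : EmbeddedSubmanifold k m S M) (q : S) :
    TangentSpace (𝓡 m) (i.incl q) →L[ℝ] i.Normal q :=
  (i.tangent q).mkQL

variable [IsManifold (𝓡 k) ∞ S] [IsManifold (𝓡 m) ∞ M]

theorem diff_injective (i : EmbeddedSubmanifold k m S M) (q : S) :
    Function.Injective (i.diff q) := by
  have h := i.isSmoothEmbedding.isImmersion.isImmersionAt q
  set φ := h.domChart
  set ψ := h.codChart
  have hφ : φ ∈ IsManifold.maximalAtlas (𝓡 k) ∞ S := h.domChart_mem_maximalAtlas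
  have hψ : ψ ∈ IsManifold.maximalAtlas (𝓡 m) ∞ M := h.codChart_mem_maximalAtlas
  have hq : q ∈ φ.source := h.mem_domChart_source
  have hiq : i.incl q ∈ ψ.source := h.mem_codChart_source
  have hw := h.writtenInCharts
  have hφs : MDifferentiableAt (𝓡 k) (𝓡 k) φ.symm (φ q) :=
    ((contMDiffOn_symm_of_mem_maximalAtlas hφ).contMDiffAt
      (φ.open_target.mem_nhds (φ.map_source hq))).mdifferentiableAt (by simp)
  have hφd : MDifferentiableAt (𝓡 k) (𝓡 k) φ q :=
    ((contMDiffOn_of_mem_maximalAtlas hφ).contMDiffAt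
      (φ.open_source.mem_nhds hq)).mdifferentiableAt (by simp)
  have hψd : MDifferentiableAt (𝓡 m) (𝓡 m) ψ (i.incl q) :=
    ((contMDiffOn_of_mem_maximalAtlas hψ).contMDiffAt
      (ψ.open_source.mem_nhds hiq)).mdifferentiableAt (by simp)
  have hi : MDifferentiableAt (𝓡 k) (𝓡 m) i.incl q := i.contMDiff.mdifferentiableAt (by simp)
  let g : EuclideanSpace ℝ (Fin k) →L[ℝ] EuclideanSpace ℝ (Fin m) :=
    h.equiv.toContinuousLinearMap.comp (ContinuousLinearMap.inl ℝ _ h.complement)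
  -- near `q`, the inclusion read in the chart of `M` is `g ∘ φ`
  have hev : (ψ ∘ i.incl) =ᶠ[𝓝 q] (g ∘ φ) := by
    filter_upwards [φ.open_source.mem_nhds hq] with p hp
    have := hw (x := φ p) (by simpa using φ.map_source hp)
    have hps : h.domChart.symm (φ p) = p := φ.left_inv hp
    simpa [g, hps] using this
  have h1 : mfderiv (𝓡 k) (𝓡 m) (ψ ∘ i.incl) q = mfderiv (𝓡 k) (𝓡 m) (g ∘ φ) q :=
    hev.mfderiv_eq
  have hg : MDifferentiableAt (𝓡 k) (𝓡 m) g (φ q) :=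
    g.differentiableAt.mdifferentiableAt
  rw [mfderiv_comp q hψd hi, mfderiv_comp q hg hφd, ContinuousLinearMap.mfderiv_eq] at h1
  have hinjφ : Function.Injective (mfderiv (𝓡 k) (𝓡 k) φ q) := by
    have hid : (φ.symm ∘ φ) =ᶠ[𝓝 q] id := by
      filter_upwards [φ.open_source.mem_nhds hq] with p hp using φ.left_inv hp
    have h2 := hid.mfderiv_eq (I := 𝓡 k) (I' := 𝓡 k)
    rw [mfderiv_comp q hφs hφd, mfderiv_id] at h2
    intro u v huv
    have hu := DFunLike.congr_fun h2 u
    have hv := DFunLike.congr_fun h2 v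
    simp only [ContinuousLinearMap.comp_apply] at hu hv
    rw [huv] at hu
    exact (hu.symm.trans hv)
  have hinjg : Function.Injective g := by
    intro u v huv
    have := h.equiv.injective huv
    simpa using this
  intro u v huv
  apply hinjφ
  apply hinjg
  have hu := DFunLike.congr_fun h1 u
  have hv := DFunLike.congr_fun h1 v
  simp only [ContinuousLinearMap.comp_apply] at hu hv
  have huv' : mfderiv (𝓡 k) (𝓡 m) i.incl q u = mfderiv (𝓡 k) (𝓡 m) i.incl q v := huv
  rw [huv'] at hu
  exact hu.symm.trans hv


/-- The coordinate change matrix of `dι` near `x₀`. -/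
noncomputable def diffCoord (i : EmbeddedSubmanifold k m S M) (x₀ q : S) :
    EuclideanSpace ℝ (Fin k) →L[ℝ] EuclideanSpace ℝ (Fin m) :=
  ((trivializationAt (EuclideanSpace ℝ (Fin m)) (TangentSpace (𝓡 m)) (i.incl x₀)).continuousLinearMapAt
    ℝ (i.incl q)).comp ((i.diff q).comp
    ((trivializationAt (EuclideanSpace ℝ (Fin k)) (TangentSpace (𝓡 k)) x₀).symmL ℝ q))

/-- The points at which both tangent bundles are trivialized by the charts at `x₀`, `ι x₀`. -/
def chartSet (i : EmbeddedSubmanifold k m S M) (x₀ : S) : Set S :=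
  (chartAt (EuclideanSpace ℝ (Fin k)) x₀).source ∩
    i.incl ⁻¹' (chartAt (EuclideanSpace ℝ (Fin m)) (i.incl x₀)).source

theorem isOpen_chartSet (i : EmbeddedSubmanifold k m S M) (x₀ : S) : IsOpen (i.chartSet x₀) :=
  (chartAt _ x₀).open_source.inter
    ((chartAt _ (i.incl x₀)).open_source.preimage i.contMDiff.continuous)

theorem contMDiffOn_diffCoord (i : EmbeddedSubmanifold k m S M) (x₀ : S) :
    ContMDiffOn (𝓡 k) 𝓘(ℝ, EuclideanSpace ℝ (Fin k) →L[ℝ] EuclideanSpace ℝ (Fin m)) ∞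
      (i.diffCoord x₀) (i.chartSet x₀) := by
  intro q₁ hq₁
  apply ContMDiffAt.contMDiffWithinAt
  let eM := trivializationAt (EuclideanSpace ℝ (Fin m)) (TangentSpace (𝓡 m) (M := M))
  let eS := trivializationAt (EuclideanSpace ℝ (Fin k)) (TangentSpace (𝓡 k) (M := S))
  have h1 : ContMDiffAt (𝓡 k) 𝓘(ℝ, EuclideanSpace ℝ (Fin k) →L[ℝ] EuclideanSpace ℝ (Fin m)) ∞
      (inTangentCoordinates (𝓡 k) (𝓡 m) id i.incl (mfderiv (𝓡 k) (𝓡 m) i.incl) q₁) q₁ :=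
    (i.contMDiff q₁).mfderiv_const (by simp)
  have h2 : ContMDiffAt (𝓡 k) 𝓘(ℝ, EuclideanSpace ℝ (Fin k) →L[ℝ] EuclideanSpace ℝ (Fin k)) ∞
      (fun q => ((eS x₀).coordChangeL ℝ (eS q₁) q :
      EuclideanSpace ℝ (Fin k) →L[ℝ] EuclideanSpace ℝ (Fin k))) q₁ :=
    contMDiffAt_coordChangeL (e := eS x₀) (e' := eS q₁) hq₁.1 (mem_chart_source _ q₁)
  have h3 : ContMDiffAt (𝓡 m) 𝓘(ℝ, EuclideanSpace ℝ (Fin m) →L[ℝ] EuclideanSpace ℝ (Fin m)) ∞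
      (fun q => ((eM (i.incl q₁)).coordChangeL ℝ (eM (i.incl x₀)) q :
      EuclideanSpace ℝ (Fin m) →L[ℝ] EuclideanSpace ℝ (Fin m))) (i.incl q₁) :=
    contMDiffAt_coordChangeL (e := eM (i.incl q₁)) (e' := eM (i.incl x₀))
      (mem_chart_source _ (i.incl q₁)) hq₁.2
  have h4 := (h3.comp q₁ (i.contMDiff q₁)).clm_comp (h1.clm_comp h2)
  refine h4.congr_of_eventuallyEq ?_
  filter_upwards [(i.isOpen_chartSet x₀).mem_nhds hq₁, (i.isOpen_chartSet q₁).mem_nhds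
    ⟨mem_chart_source _ q₁, mem_chart_source _ (i.incl q₁)⟩] with q hx hq
  ext1 w
  have e1 : ((eS x₀).coordChangeL ℝ (eS q₁) q :
      EuclideanSpace ℝ (Fin k) →L[ℝ] EuclideanSpace ℝ (Fin k)) w
      = (eS q₁).continuousLinearMapAt ℝ q ((eS x₀).symmL ℝ q w) := by
    rw [ContinuousLinearEquiv.coe_coe, Trivialization.coordChangeL_apply _ _ ⟨hx.1, hq.1⟩,
      Trivialization.continuousLinearMapAt_apply, Trivialization.linearMapAt_apply, if_pos (by exact hq.1),
      Trivialization.symmL_apply _ (by exact hx.1)]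
  have e3 : ∀ v, ((eM (i.incl q₁)).coordChangeL ℝ (eM (i.incl x₀)) (i.incl q) :
      EuclideanSpace ℝ (Fin m) →L[ℝ] EuclideanSpace ℝ (Fin m)) v
      = (eM (i.incl x₀)).continuousLinearMapAt ℝ (i.incl q)
        ((eM (i.incl q₁)).symmL ℝ (i.incl q) v) := by
    intro v
    rw [ContinuousLinearEquiv.coe_coe, Trivialization.coordChangeL_apply _ _ ⟨hq.2, hx.2⟩,
      Trivialization.continuousLinearMapAt_apply, Trivialization.linearMapAt_apply, if_pos (by exact hx.2),
      Trivialization.symmL_apply _ (by exact hq.2)]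
  have e2 : ∀ v, inTangentCoordinates (𝓡 k) (𝓡 m) id i.incl (mfderiv (𝓡 k) (𝓡 m) i.incl) q₁ q v
      = (eM (i.incl q₁)).continuousLinearMapAt ℝ (i.incl q)
        (i.diff q ((eS q₁).symmL ℝ q v)) := fun v => rfl
  simp only [ContinuousLinearMap.comp_apply, Function.comp_apply]
  rw [e1, e2, e3, Trivialization.symmL_continuousLinearMapAt _ (by exact hq.2),
    Trivialization.symmL_continuousLinearMapAt _ (by exact hq.1)]
  rfl

theorem chartSet_self (i : EmbeddedSubmanifold k m S M) (x₀ : S) : x₀ ∈ i.chartSet x₀ :=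
  ⟨mem_chart_source _ x₀, mem_chart_source _ (i.incl x₀)⟩

/-- Trivialization of `T_{ι q}M` near `x₀`, as a total linear map. -/
noncomputable def toModel (i : EmbeddedSubmanifold k m S M) (x₀ q : S) :
    TangentSpace (𝓡 m) (i.incl q) →L[ℝ] EuclideanSpace ℝ (Fin m) :=
  (trivializationAt (EuclideanSpace ℝ (Fin m)) (TangentSpace (𝓡 m))
    (i.incl x₀)).continuousLinearMapAt ℝ (i.incl q)

/-- The inverse of `toModel`. -/
noncomputable def ofModel (i : EmbeddedSubmanifold k m S M) (x₀ q : S) :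
    EuclideanSpace ℝ (Fin m) →L[ℝ] TangentSpace (𝓡 m) (i.incl q) :=
  (trivializationAt (EuclideanSpace ℝ (Fin m)) (TangentSpace (𝓡 m))
    (i.incl x₀)).symmL ℝ (i.incl q)

theorem ofModel_toModel (i : EmbeddedSubmanifold k m S M) {x₀ q : S} (h : q ∈ i.chartSet x₀)
    (t : TangentSpace (𝓡 m) (i.incl q)) : i.ofModel x₀ q (i.toModel x₀ q t) = t :=
  Trivialization.symmL_continuousLinearMapAt _ (by exact h.2) t

theorem toModel_ofModel (i : EmbeddedSubmanifold k m S M) {x₀ q : S} (h : q ∈ i.chartSet x₀)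
    (t : EuclideanSpace ℝ (Fin m)) : i.toModel x₀ q (i.ofModel x₀ q t) = t :=
  Trivialization.continuousLinearMapAt_symmL _ (by exact h.2) t

theorem exists_lift_diffCoord (i : EmbeddedSubmanifold k m S M) {x₀ q : S}
    (h : q ∈ i.chartSet x₀) (u : TangentSpace (𝓡 k) q) :
    ∃ w, i.diffCoord x₀ q w = i.toModel x₀ q (i.diff q u) :=
  ⟨(trivializationAt (EuclideanSpace ℝ (Fin k)) (TangentSpace (𝓡 k)) x₀).continuousLinearMapAt
    ℝ q u, by
    simp only [diffCoord, toModel, ContinuousLinearMap.comp_apply]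
    rw [Trivialization.symmL_continuousLinearMapAt _ (by exact h.1)]⟩

theorem ofModel_diffCoord (i : EmbeddedSubmanifold k m S M) {x₀ q : S}
    (h : q ∈ i.chartSet x₀) (w : EuclideanSpace ℝ (Fin k)) :
    i.ofModel x₀ q (i.diffCoord x₀ q w) ∈ i.tangent q := by
  have : i.diffCoord x₀ q w = i.toModel x₀ q (i.diff q
    ((trivializationAt (EuclideanSpace ℝ (Fin k)) (TangentSpace (𝓡 k)) x₀).symmL ℝ q w)) := rfl
  rw [this, i.ofModel_toModel h]
  exact ⟨_, rfl⟩

theorem exists_complement (i : EmbeddedSubmanifold k m S M) (x₀ : S) :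
    ∃ j : EuclideanSpace ℝ (Fin (m - k)) →L[ℝ] EuclideanSpace ℝ (Fin m),
      ((i.diffCoord x₀ x₀).coprod j).IsInvertible := by
  have hinj : Function.Injective (i.diffCoord x₀ x₀).toLinearMap := by
    intro u v huv
    let eS := trivializationAt (EuclideanSpace ℝ (Fin k)) (TangentSpace (𝓡 k)) x₀
    have hS : x₀ ∈ eS.baseSet := (i.chartSet_self x₀).1
    have h1 : i.diff x₀ (eS.symmL ℝ x₀ u) = i.diff x₀ (eS.symmL ℝ x₀ v) := by
      have h0 := congrArg (i.ofModel x₀ x₀) huv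
      exact ((i.ofModel_toModel (i.chartSet_self x₀) _).symm.trans h0).trans
        (i.ofModel_toModel (i.chartSet_self x₀) _)
    have h2 := congrArg (eS.continuousLinearMapAt ℝ x₀) (i.diff_injective x₀ h1)
    simpa only [eS.continuousLinearMapAt_symmL hS] using h2
  obtain ⟨C, hC⟩ := Submodule.exists_isCompl (LinearMap.range (i.diffCoord x₀ x₀).toLinearMap)
  have hdim : Module.finrank ℝ (EuclideanSpace ℝ (Fin (m - k))) = Module.finrank ℝ C := by
    have h1 := Submodule.finrank_add_eq_of_isCompl hC
    rw [LinearMap.finrank_range_of_inj hinj] at h1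
    simp only [finrank_euclideanSpace, Fintype.card_fin] at h1 ⊢
    omega
  let f := LinearEquiv.ofFinrankEq _ _ hdim
  let g := LinearEquiv.ofInjective _ hinj
  let T := (g.prodCongr f).trans (Submodule.prodEquivOfIsCompl _ _ hC)
  refine ⟨(C.subtype ∘ₗ f.toLinearMap).toContinuousLinearMap, T.toContinuousLinearEquiv, ?_⟩
  ext x <;> simp [T, g, f]

/-- A linear complement, in the model space, to `T_{x₀}S`. -/
noncomputable def compl (i : EmbeddedSubmanifold k m S M) (x₀ : S) :
    EuclideanSpace ℝ (Fin (m - k)) →L[ℝ] EuclideanSpace ℝ (Fin m) :=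
  (i.exists_complement x₀).choose

/-- The map `(u, v) ↦ dι_q(u) + v` in the charts at `x₀`, `ι x₀`. -/
noncomputable def frame (i : EmbeddedSubmanifold k m S M) (x₀ q : S) :
    (EuclideanSpace ℝ (Fin k) × EuclideanSpace ℝ (Fin (m - k))) →L[ℝ] EuclideanSpace ℝ (Fin m) :=
  (i.diffCoord x₀ q).coprod (i.compl x₀)

/-- The open set over which the complement chosen at `x₀` trivializes the normal bundle. -/
def trivSet (i : EmbeddedSubmanifold k m S M) (x₀ : S) : Set S :=
  {q | q ∈ i.chartSet x₀ ∧ (i.frame x₀ q).IsInvertible}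

theorem mem_trivSet_self (i : EmbeddedSubmanifold k m S M) (x₀ : S) : x₀ ∈ i.trivSet x₀ :=
  ⟨i.chartSet_self x₀, (i.exists_complement x₀).choose_spec⟩

theorem contMDiffOn_frame (i : EmbeddedSubmanifold k m S M) (x₀ : S) :
    ContMDiffOn (𝓡 k) 𝓘(ℝ, (EuclideanSpace ℝ (Fin k) × EuclideanSpace ℝ (Fin (m - k))) →L[ℝ]
      EuclideanSpace ℝ (Fin m)) ∞ (i.frame x₀) (i.chartSet x₀) := by
  have h : i.frame x₀ = fun q => (i.diffCoord x₀ q).comp (ContinuousLinearMap.fst ℝ _ _)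
      + (i.compl x₀).comp (ContinuousLinearMap.snd ℝ _ _) := by
    funext q
    ext x <;> simp [frame]
  rw [h]
  exact ((i.contMDiffOn_diffCoord x₀).clm_comp contMDiffOn_const).add contMDiffOn_const

theorem isOpen_trivSet (i : EmbeddedSubmanifold k m S M) (x₀ : S) : IsOpen (i.trivSet x₀) := by
  have := (i.contMDiffOn_frame x₀).continuousOn.isOpen_inter_preimage (i.isOpen_chartSet x₀)
    (ContinuousLinearEquiv.isOpen (𝕜 := ℝ)
      (E := EuclideanSpace ℝ (Fin k) × EuclideanSpace ℝ (Fin (m - k)))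
      (F := EuclideanSpace ℝ (Fin m)))
  exact this

/-- The linear map `T_{ι q}M → ℝ^{m-k}`, with kernel `T_qS` for `q ∈ trivSet x₀`. -/
noncomputable def proj (i : EmbeddedSubmanifold k m S M) (x₀ q : S) :
    TangentSpace (𝓡 m) (i.incl q) →L[ℝ] EuclideanSpace ℝ (Fin (m - k)) :=
  (ContinuousLinearMap.snd ℝ (EuclideanSpace ℝ (Fin k)) (EuclideanSpace ℝ (Fin (m - k)))).comp
    ((i.frame x₀ q).inverse.comp (i.toModel x₀ q))

theorem tangent_le_ker_proj (i : EmbeddedSubmanifold k m S M) {x₀ q : S} (h : q ∈ i.trivSet x₀) :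
    i.tangent q ≤ LinearMap.ker (i.proj x₀ q).toLinearMap := by
  rintro _ ⟨u, rfl⟩
  obtain ⟨w, hw⟩ := i.exists_lift_diffCoord h.1 u
  have h1 : i.frame x₀ q (w, 0) = i.toModel x₀ q (i.diff q u) := by simp [frame, hw]
  have h2 : (i.frame x₀ q).inverse (i.frame x₀ q (w, 0)) = (w, 0) :=
    DFunLike.congr_fun h.2.inverse_comp_self (w, 0)
  simp only [LinearMap.mem_ker, ContinuousLinearMap.coe_coe, proj, ContinuousLinearMap.comp_apply]
  rw [← h1, h2]
  rfl

/-- A linear map on `T_{ι q}M` vanishing on `T_qS` descends to `E_q`. -/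
noncomputable def descend (i : EmbeddedSubmanifold k m S M) (q : S)
    (f : TangentSpace (𝓡 m) (i.incl q) →ₗ[ℝ] EuclideanSpace ℝ (Fin (m - k)))
    (h : i.tangent q ≤ LinearMap.ker f) : i.Normal q →ₗ[ℝ] EuclideanSpace ℝ (Fin (m - k)) :=
  (i.tangent q).liftQ f h

open Classical in
/-- The fiber coordinate `E_q → ℝ^{m-k}` induced by `proj` (for `q ∈ trivSet x₀`). -/
noncomputable def coord (i : EmbeddedSubmanifold k m S M) (x₀ q : S) :
    i.Normal q →ₗ[ℝ] EuclideanSpace ℝ (Fin (m - k)) :=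
  if h : q ∈ i.trivSet x₀ then
    i.descend q (i.proj x₀ q).toLinearMap (i.tangent_le_ker_proj h) else 0

/-- The inverse of `coord`. -/
noncomputable def coordInv (i : EmbeddedSubmanifold k m S M) (x₀ q : S) :
    EuclideanSpace ℝ (Fin (m - k)) →L[ℝ] i.Normal q :=
  (i.nu q).comp ((i.ofModel x₀ q).comp (i.compl x₀))

theorem coord_nu (i : EmbeddedSubmanifold k m S M) {x₀ q : S} (h : q ∈ i.trivSet x₀)
    (t : TangentSpace (𝓡 m) (i.incl q)) : i.coord x₀ q (i.nu q t) = i.proj x₀ q t := by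
  rw [coord, dif_pos h]
  rfl

theorem nu_surjective (i : EmbeddedSubmanifold k m S M) (q : S) :
    Function.Surjective (i.nu q) :=
  (i.tangent q).mkQ_surjective

theorem continuous_coord (i : EmbeddedSubmanifold k m S M) {x₀ q : S} (h : q ∈ i.trivSet x₀) :
    Continuous (i.coord x₀ q) := by
  have hq : IsQuotientMap (i.nu q) := isQuotientMap_quotient_mk'
  rw [hq.continuous_iff]
  exact (i.proj x₀ q).continuous.congr fun t => (i.coord_nu h t).symm

theorem coord_coordInv (i : EmbeddedSubmanifold k m S M) {x₀ q : S} (h : q ∈ i.trivSet x₀)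
    (v : EuclideanSpace ℝ (Fin (m - k))) : i.coord x₀ q (i.coordInv x₀ q v) = v := by
  have h1 : i.coord x₀ q (i.coordInv x₀ q v) = i.proj x₀ q (i.ofModel x₀ q (i.compl x₀ v)) :=
    i.coord_nu h _
  have h3 : i.frame x₀ q (0, v) = i.compl x₀ v := by simp [frame]
  have h2 : (i.frame x₀ q).inverse (i.frame x₀ q (0, v)) = (0, v) :=
    DFunLike.congr_fun h.2.inverse_comp_self (0, v)
  rw [h1]
  simp only [proj, ContinuousLinearMap.comp_apply]
  rw [i.toModel_ofModel h.1, ← h3, h2]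
  rfl

theorem coordInv_coord (i : EmbeddedSubmanifold k m S M) {x₀ q : S} (h : q ∈ i.trivSet x₀)
    (n : i.Normal q) : i.coordInv x₀ q (i.coord x₀ q n) = n := by
  obtain ⟨t, rfl⟩ := i.nu_surjective q n
  rw [i.coord_nu h]
  obtain ⟨e, he⟩ := h.2
  set p := (i.frame x₀ q).inverse (i.toModel x₀ q t) with hp
  have h1 : i.frame x₀ q p = i.toModel x₀ q t := by
    rw [hp, ← he, ContinuousLinearMap.inverse_equiv]
    simp
  have h2 : i.toModel x₀ q t = i.diffCoord x₀ q p.1 + i.compl x₀ p.2 := by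
    rw [← h1]; simp [frame]
  have h3 : i.proj x₀ q t = p.2 := rfl
  rw [h3]
  change i.nu q (i.ofModel x₀ q (i.compl x₀ p.2)) = i.nu q t
  have h4 : t = i.ofModel x₀ q (i.diffCoord x₀ q p.1) + i.ofModel x₀ q (i.compl x₀ p.2) := by
    rw [← map_add, ← h2, i.ofModel_toModel h.1]
  symm
  refine (Submodule.Quotient.eq (i.tangent q)).2 ?_
  have h5 : t - i.ofModel x₀ q (i.compl x₀ p.2) = i.ofModel x₀ q (i.diffCoord x₀ q p.1) := by
    nth_rewrite 1 [h4]; simp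
  rw [h5]
  exact i.ofModel_diffCoord h.1 _

/-- The fiber coordinate as a linear homeomorphism. -/
noncomputable def coordEquiv (i : EmbeddedSubmanifold k m S M) {x₀ q : S}
    (h : q ∈ i.trivSet x₀) : i.Normal q ≃L[ℝ] EuclideanSpace ℝ (Fin (m - k)) where
  toLinearMap := i.coord x₀ q
  invFun := i.coordInv x₀ q
  left_inv := i.coordInv_coord h
  right_inv := i.coord_coordInv h
  continuous_toFun := i.continuous_coord h
  continuous_invFun := (i.coordInv x₀ q).continuous

/-- The local trivialization of the normal bundle near `x₀`. -/
noncomputable def pretriv (i : EmbeddedSubmanifold k m S M) (x₀ : S) :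
    Pretrivialization (EuclideanSpace ℝ (Fin (m - k)))
      (π (EuclideanSpace ℝ (Fin (m - k))) i.Normal) where
  toFun z := (z.proj, i.coord x₀ z.proj z.snd)
  invFun z := ⟨z.1, i.coordInv x₀ z.1 z.2⟩
  source := π _ i.Normal ⁻¹' i.trivSet x₀
  target := i.trivSet x₀ ×ˢ univ
  map_source' z hz := ⟨hz, mem_univ _⟩
  map_target' z hz := hz.1
  left_inv' := by
    rintro ⟨q, n⟩ hq
    simp only [TotalSpace.mk_inj]
    exact i.coordInv_coord hq n
  right_inv' := by
    rintro ⟨q, v⟩ hq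
    simp only [Prod.mk.injEq, true_and]
    exact i.coord_coordInv hq.1 v
  open_target := (i.isOpen_trivSet x₀).prod isOpen_univ
  baseSet := i.trivSet x₀
  open_baseSet := i.isOpen_trivSet x₀
  source_eq := rfl
  target_eq := rfl
  proj_toFun _ _ := rfl

instance (i : EmbeddedSubmanifold k m S M) (x₀ : S) : (i.pretriv x₀).IsLinear ℝ where
  linear q _ := (i.coord x₀ q).isLinear

/-- The transition matrix between two trivializations. -/
noncomputable def transition (i : EmbeddedSubmanifold k m S M) (x y q : S) :
    EuclideanSpace ℝ (Fin (m - k)) →L[ℝ] EuclideanSpace ℝ (Fin (m - k)) :=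
  (i.proj y q).comp ((i.ofModel x q).comp (i.compl x))

theorem pretriv_symm_apply (i : EmbeddedSubmanifold k m S M) {x q : S} (h : q ∈ i.trivSet x)
    (v : EuclideanSpace ℝ (Fin (m - k))) : (i.pretriv x).symm q v = i.coordInv x q v := by
  rw [Pretrivialization.symm_apply _ h]
  rfl

theorem transition_eq (i : EmbeddedSubmanifold k m S M) {x y q : S}
    (h : q ∈ i.trivSet x ∩ i.trivSet y) (v : EuclideanSpace ℝ (Fin (m - k))) :
    i.transition x y q v = ((i.pretriv y) ⟨q, (i.pretriv x).symm q v⟩).2 := by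
  rw [i.pretriv_symm_apply h.1]
  exact (i.coord_nu h.2 _).symm

theorem contMDiffOn_transition (i : EmbeddedSubmanifold k m S M) (x y : S) :
    ContMDiffOn (𝓡 k) 𝓘(ℝ, EuclideanSpace ℝ (Fin (m - k)) →L[ℝ] EuclideanSpace ℝ (Fin (m - k))) ∞
      (i.transition x y) (i.trivSet x ∩ i.trivSet y) := by
  intro q hq
  apply ContMDiffAt.contMDiffWithinAt
  let eM := trivializationAt (EuclideanSpace ℝ (Fin m)) (TangentSpace (𝓡 m) (M := M))
  have h1 : ContMDiffAt (𝓡 m) 𝓘(ℝ, EuclideanSpace ℝ (Fin m) →L[ℝ] EuclideanSpace ℝ (Fin m)) ∞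
      (fun p => ((eM (i.incl x)).coordChangeL ℝ (eM (i.incl y)) p :
        EuclideanSpace ℝ (Fin m) →L[ℝ] EuclideanSpace ℝ (Fin m))) (i.incl q) :=
    contMDiffAt_coordChangeL (e := eM (i.incl x)) (e' := eM (i.incl y)) hq.1.1.2 hq.2.1.2
  have h2 := h1.comp q (i.contMDiff q)
  have h3 : ContMDiffAt (𝓡 k) 𝓘(ℝ, EuclideanSpace ℝ (Fin m) →L[ℝ]
      (EuclideanSpace ℝ (Fin k) × EuclideanSpace ℝ (Fin (m - k)))) ∞
      (fun p => (i.frame y p).inverse) q := by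
    obtain ⟨e, he⟩ := hq.2.2
    have hinv : ContDiffAt ℝ ∞ (ContinuousLinearMap.inverse :
      ((EuclideanSpace ℝ (Fin k) × EuclideanSpace ℝ (Fin (m - k))) →L[ℝ] EuclideanSpace ℝ (Fin m))
        → _) (i.frame y q) := he ▸ contDiffAt_map_inverse e
    exact hinv.contMDiffAt.comp q
      ((i.contMDiffOn_frame y).contMDiffAt ((i.isOpen_chartSet y).mem_nhds hq.2.1))
  have h4 := (contMDiffAt_const (c := ContinuousLinearMap.snd ℝ (EuclideanSpace ℝ (Fin k))
    (EuclideanSpace ℝ (Fin (m - k))))).clm_comp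
      (h3.clm_comp (h2.clm_comp (contMDiffAt_const (c := i.compl x))))
  refine h4.congr_of_eventuallyEq ?_
  filter_upwards [((i.isOpen_trivSet x).inter (i.isOpen_trivSet y)).mem_nhds hq] with p hp
  ext1 v
  have e3 : ∀ v, ((eM (i.incl x)).coordChangeL ℝ (eM (i.incl y)) (i.incl p) :
      EuclideanSpace ℝ (Fin m) →L[ℝ] EuclideanSpace ℝ (Fin m)) v
      = i.toModel y p (i.ofModel x p v) := by
    intro v
    rw [ContinuousLinearEquiv.coe_coe, Trivialization.coordChangeL_apply _ _ ⟨hp.1.1.2, hp.2.1.2⟩,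
      toModel, ofModel, Trivialization.continuousLinearMapAt_apply,
      Trivialization.linearMapAt_apply, if_pos (by exact hp.2.1.2),
      Trivialization.symmL_apply _ (by exact hp.1.1.2)]
  simp only [ContinuousLinearMap.comp_apply, Function.comp_apply, transition, proj]
  rw [e3]

/-- The vector bundle structure of the normal bundle `E = T_SM / TS`. -/
noncomputable def prebundle (i : EmbeddedSubmanifold k m S M) :
    VectorPrebundle ℝ (EuclideanSpace ℝ (Fin (m - k))) i.Normal where
  pretrivializationAtlas := range i.pretriv
  pretrivialization_linear' := by rintro _ ⟨x, rfl⟩; infer_instance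
  pretrivializationAt := i.pretriv
  mem_base_pretrivializationAt := i.mem_trivSet_self
  pretrivialization_mem_atlas x := ⟨x, rfl⟩
  exists_coordChange := by
    rintro _ ⟨x, rfl⟩ _ ⟨y, rfl⟩
    exact ⟨i.transition x y, (i.contMDiffOn_transition x y).continuousOn,
      fun q hq v => i.transition_eq hq v⟩
  totalSpaceMk_isInducing x := by
    exact isInducing_const_prod.mpr
      (i.coordEquiv (i.mem_trivSet_self x)).toHomeomorph.isInducing

noncomputable instance (i : EmbeddedSubmanifold k m S M) :
    TopologicalSpace (TotalSpace (EuclideanSpace ℝ (Fin (m - k))) i.Normal) :=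
  i.prebundle.totalSpaceTopology

noncomputable instance (i : EmbeddedSubmanifold k m S M) :
    FiberBundle (EuclideanSpace ℝ (Fin (m - k))) i.Normal :=
  i.prebundle.toFiberBundle

instance (i : EmbeddedSubmanifold k m S M) :
    VectorBundle ℝ (EuclideanSpace ℝ (Fin (m - k))) i.Normal :=
  i.prebundle.toVectorBundle

instance (i : EmbeddedSubmanifold k m S M) : i.prebundle.IsContMDiff (𝓡 k) ∞ where
  exists_contMDiffCoordChange := by
    rintro _ ⟨x, rfl⟩ _ ⟨y, rfl⟩
    exact ⟨i.transition x y, i.contMDiffOn_transition x y, fun q hq v => i.transition_eq hq v⟩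

instance (i : EmbeddedSubmanifold k m S M) :
    ContMDiffVectorBundle ∞ (EuclideanSpace ℝ (Fin (m - k))) i.Normal (𝓡 k) :=
  i.prebundle.contMDiffVectorBundle (𝓡 k)

end EmbeddedSubmanifold

/-! ### Smooth functions, one-forms and Poisson structures -/

section Poisson

variable {d : ℕ} {N : Type*} [TopologicalSpace N] [ChartedSpace (EuclideanSpace ℝ (Fin d)) N]

/-- The differential `d_x f ∈ T*_xN` of a function. -/
noncomputable def dAt (f : N → ℝ) (x : N) : TangentSpace (𝓡 d) x →L[ℝ] ℝ :=
  mfderiv (𝓡 d) 𝓘(ℝ) f x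

variable [IsManifold (𝓡 d) ∞ N]

variable (d N) in
/-- Smooth one-forms, i.e. smooth sections of the cotangent bundle. -/
abbrev OneForm : Type _ :=
  Cₛ^∞⟮𝓡 d; EuclideanSpace ℝ (Fin d) →L[ℝ] ℝ, fun x : N => TangentSpace (𝓡 d) x →L[ℝ] ℝ⟯

/-- The differential of a smooth function as a one-form. -/
noncomputable def differential (f : C^∞⟮𝓡 d, N; ℝ⟯) : OneForm d N where
  toFun := dAt f
  contMDiff_toFun := by
    intro x
    rw [contMDiffAt_hom_bundle]
    refine ⟨contMDiffAt_id, ?_⟩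
    have h := (f.contMDiff x).mfderiv_const (m := ∞) (by simp)
    refine h.congr_of_eventuallyEq (Filter.Eventually.of_forall fun y => ?_)
    ext v
    simp only [inTangentCoordinates, ContinuousLinearMap.inCoordinates,
      ContinuousLinearMap.comp_apply, id]
    rw [TangentBundle.continuousLinearMapAt_model_space]
    erw [Bundle.Trivial.continuousLinearMapAt_trivialization]
    rfl

variable (d N) in
/-- A smooth bivector field `Π ∈ Γ(Λ²TN)`, given by the associated skew-symmetric bundle map
`Π♯ : T*N → TN`, `Π♯ α = i_α Π`, so that `Π(α, β) = ⟨β, Π♯ α⟩`. -/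
structure Bivector where
  sharp : Cₛ^∞⟮𝓡 d; (EuclideanSpace ℝ (Fin d) →L[ℝ] ℝ) →L[ℝ] EuclideanSpace ℝ (Fin d),
    fun x : N => (TangentSpace (𝓡 d) x →L[ℝ] ℝ) →L[ℝ] TangentSpace (𝓡 d) x⟯
  alternating : ∀ (x : N) (α : TangentSpace (𝓡 d) x →L[ℝ] ℝ), α (sharp x α) = 0

/-- The bracket `Π(df, dg)`, as a pointwise expression. -/
noncomputable def Bivector.bracketAt (B : Bivector d N) (f g : N → ℝ) (x : N) : ℝ :=
  dAt g x (B.sharp x (dAt f x))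

/-- The bracket `{f, g} = Π(df, dg)` of smooth functions. -/
noncomputable def Bivector.bracket (B : Bivector d N) (f g : C^∞⟮𝓡 d, N; ℝ⟯) :
    C^∞⟮𝓡 d, N; ℝ⟯ :=
  ⟨B.bracketAt f g, by
    have h1 := ContMDiff.clm_bundle_apply (b := id) B.sharp.contMDiff (differential f).contMDiff
    have h2 := ContMDiff.clm_bundle_apply (b := id) (E₂ := Bundle.Trivial N ℝ)
      (differential g).contMDiff h1
    intro x
    exact (contMDiffAt_totalSpace.1 (h2 x)).2⟩

variable (d N) in
/-- A Poisson structure: a bivector field whose bracket satisfies the Jacobi identity. -/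
structure PoissonStructure extends Bivector d N where
  jacobi : ∀ f g h : C^∞⟮𝓡 d, N; ℝ⟯,
    toBivector.bracket f (toBivector.bracket g h) + toBivector.bracket g (toBivector.bracket h f)
      + toBivector.bracket h (toBivector.bracket f g) = 0

/-- A one-form read in the preferred chart at `x`. -/
noncomputable def OneForm.inChart (α : OneForm d N) (x : N) (y : EuclideanSpace ℝ (Fin d)) :
    EuclideanSpace ℝ (Fin d) →L[ℝ] ℝ :=
  (α ((extChartAt (𝓡 d) x).symm y)).comp
    (mfderiv 𝓘(ℝ, EuclideanSpace ℝ (Fin d)) (𝓡 d) (extChartAt (𝓡 d) x).symm y)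

/-- The exterior derivative `(dα)_x(u, w)` of a one-form, computed in the preferred chart at `x`:
`∂_u α(w) - ∂_w α(u)`. -/
noncomputable def OneForm.extDerivAt (α : OneForm d N) (x : N) :
    TangentSpace (𝓡 d) x →L[ℝ] TangentSpace (𝓡 d) x →L[ℝ] ℝ :=
  let D := fderiv ℝ (α.inChart x) (extChartAt (𝓡 d) x x)
  let A : EuclideanSpace ℝ (Fin d) →L[ℝ] EuclideanSpace ℝ (Fin d) :=
    mfderiv (𝓡 d) 𝓘(ℝ, EuclideanSpace ℝ (Fin d)) (extChartAt (𝓡 d) x) x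
  let C : EuclideanSpace ℝ (Fin d) →L[ℝ] EuclideanSpace ℝ (Fin d) →L[ℝ] ℝ :=
    (D - D.flip).bilinearComp A A
  C

/-- The bracket of the cotangent Lie algebroid,
`[α, β]_A = i_{Π♯ α} dβ - i_{Π♯ β} dα - d⟨α, Π♯ β⟩`, at the point `x`. -/
noncomputable def Bivector.formBracketAt (B : Bivector d N) (α β : OneForm d N) (x : N) :
    TangentSpace (𝓡 d) x →L[ℝ] ℝ :=
  β.extDerivAt x (B.sharp x (α x)) - α.extDerivAt x (B.sharp x (β x))
    - dAt (fun y => α y (B.sharp y (β y))) x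

end Poisson

namespace EmbeddedSubmanifold

variable {k m : ℕ} {S M : Type*}
  [TopologicalSpace S] [ChartedSpace (EuclideanSpace ℝ (Fin k)) S] [IsManifold (𝓡 k) ∞ S]
  [TopologicalSpace M] [ChartedSpace (EuclideanSpace ℝ (Fin m)) M] [IsManifold (𝓡 m) ∞ M]

/-- `S` is a Poisson submanifold: `Π_q ∈ Λ²T_qS` for all `q ∈ S`, i.e. `Π_q` is the image under
`dι_q` of a bivector on `T_qS`. -/
def IsPoisson (i : EmbeddedSubmanifold k m S M) (B : Bivector m M) : Prop :=
  ∀ q : S, ∃ P : (TangentSpace (𝓡 k) q →L[ℝ] ℝ) →L[ℝ] TangentSpace (𝓡 k) q,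
    (∀ α : TangentSpace (𝓡 k) q →L[ℝ] ℝ, α (P α) = 0) ∧
    ∀ β : TangentSpace (𝓡 m) (i.incl q) →L[ℝ] ℝ,
      B.sharp (i.incl q) β = i.diff q (P (β.comp (i.diff q)))

variable {i : EmbeddedSubmanifold k m S M} {B : Bivector m M}

/-- The (unique) bivector `Π_S` induced on a Poisson submanifold, as the map `Π_S♯`. -/
noncomputable def IsPoisson.inducedSharp (h : i.IsPoisson B) (q : S) :
    (TangentSpace (𝓡 k) q →L[ℝ] ℝ) →L[ℝ] TangentSpace (𝓡 k) q :=
  (h q).choose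

/-- The induced bracket `{f, g}_S = Π_S(df, dg)`. -/
noncomputable def IsPoisson.bracketAt (h : i.IsPoisson B) (f g : S → ℝ) (q : S) : ℝ :=
  dAt g q (h.inducedSharp q (dAt f q))

/-! ### The total space of the normal bundle -/

/-- The total space `E` of the normal bundle. -/
abbrev Total (i : EmbeddedSubmanifold k m S M) : Type _ :=
  TotalSpace (EuclideanSpace ℝ (Fin (m - k))) i.Normal

variable (k m) in
/-- The model with corners of the manifold `E`. -/
noncomputable abbrev totalModel := (𝓡 k).prod 𝓘(ℝ, EuclideanSpace ℝ (Fin (m - k)))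

/-- The zero section `S → E`. -/
noncomputable def zero (i : EmbeddedSubmanifold k m S M) (q : S) : i.Total := ⟨q, 0⟩

/-- The algebra `C^∞(E)`. -/
abbrev SmoothTotal (i : EmbeddedSubmanifold k m S M) : Type _ := C^∞⟮totalModel k m, i.Total; ℝ⟯

/-- The canonical inclusion `E_q ↪ T_{0_q}E`, i.e. the differential at `0` of the inclusion of the
fiber `E_q ↪ E`, where `E_q` is identified with its model space by a linear trivialization.
Tangent spaces at equal points are identified. -/
noncomputable def vert (i : EmbeddedSubmanifold k m S M) (q : S) :
    i.Normal q →L[ℝ] TangentSpace (totalModel k m) (i.zero q) :=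
  let t := trivializationAt (EuclideanSpace ℝ (Fin (m - k))) i.Normal q
  let D : EuclideanSpace ℝ (Fin (m - k)) →L[ℝ] TangentSpace (totalModel k m) (i.zero q) :=
    mfderiv 𝓘(ℝ, EuclideanSpace ℝ (Fin (m - k))) (totalModel k m)
      (fun w => (⟨q, t.symmL ℝ q w⟩ : i.Total)) 0
  D.comp (t.continuousLinearMapAt ℝ q)

theorem contMDiff_fiber (i : EmbeddedSubmanifold k m S M) (q : S)
    (t : Trivialization (EuclideanSpace ℝ (Fin (m - k)))
      (π (EuclideanSpace ℝ (Fin (m - k))) i.Normal)) [MemTrivializationAtlas t]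
    (hq : q ∈ t.baseSet) :
    ContMDiff 𝓘(ℝ, EuclideanSpace ℝ (Fin (m - k))) (totalModel k m) ∞
      (fun w => (⟨q, t.symmL ℝ q w⟩ : i.Total)) := by
  have h1 := t.contMDiffOn_symm (n := ∞) (IB := 𝓡 k)
  have h2 : ContMDiff 𝓘(ℝ, EuclideanSpace ℝ (Fin (m - k))) (totalModel k m) ∞
      (fun w : EuclideanSpace ℝ (Fin (m - k)) => (q, w)) :=
    contMDiff_const.prodMk contMDiff_id
  refine (h1.comp_contMDiff h2 fun w => ?_).congr fun w => ?_
  · simpa [t.target_eq] using hq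
  · rw [Trivialization.symmL_apply _ hq, t.mk_symm hq]
    rfl

theorem vert_symmL (i : EmbeddedSubmanifold k m S M) (q : S)
    (t : Trivialization (EuclideanSpace ℝ (Fin (m - k)))
      (π (EuclideanSpace ℝ (Fin (m - k))) i.Normal)) [MemTrivializationAtlas t]
    (F : i.SmoothTotal) (w : EuclideanSpace ℝ (Fin (m - k))) :
    mfderiv (totalModel k m) 𝓘(ℝ) F (i.zero q) (i.vert q (t.symmL ℝ q w)) =
      fderiv ℝ (fun w => F ⟨q, t.symmL ℝ q w⟩) 0 w := by
  let u := trivializationAt (EuclideanSpace ℝ (Fin (m - k))) i.Normal q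
  have hu : q ∈ u.baseSet := FiberBundle.mem_baseSet_trivializationAt' q
  let A := (u.continuousLinearMapAt ℝ q).comp (t.symmL ℝ q)
  have h0 : (⟨q, u.symmL ℝ q 0⟩ : i.Total) = i.zero q := by rw [map_zero]; rfl
  have hF : MDifferentiableAt (totalModel k m) 𝓘(ℝ) F ⟨q, u.symmL ℝ q 0⟩ :=
    F.contMDiff.mdifferentiableAt (by simp)
  have hd := (i.contMDiff_fiber q u hu).mdifferentiableAt (x := 0) (by simp)
  have h1 := mfderiv_comp (0 : EuclideanSpace ℝ (Fin (m - k))) hF hd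
  have h2 : (fun w => F ⟨q, t.symmL ℝ q w⟩) =
      (F ∘ fun w => (⟨q, u.symmL ℝ q w⟩ : i.Total)) ∘ A := by
    funext w
    simp only [Function.comp_apply, A, ContinuousLinearMap.comp_apply]
    rw [Trivialization.symmL_continuousLinearMapAt _ hu]
  have h3 : DifferentiableAt ℝ (F ∘ fun w => (⟨q, u.symmL ℝ q w⟩ : i.Total)) (A 0) := by
    rw [map_zero, ← mdifferentiableAt_iff_differentiableAt]
    exact hF.comp 0 hd
  rw [h2, fderiv_comp (0 : EuclideanSpace ℝ (Fin (m - k))) h3 A.differentiableAt,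
    ContinuousLinearMap.fderiv, map_zero, ← mfderiv_eq_fderiv, h1]
  have h4 : ∀ z : i.Total, z = i.zero q → ∀ v : EuclideanSpace ℝ (Fin k) × EuclideanSpace ℝ (Fin (m - k)),
      (mfderiv (totalModel k m) 𝓘(ℝ) F (i.zero q) : _ → ℝ) v =
      (mfderiv (totalModel k m) 𝓘(ℝ) F z : _ → ℝ) v := by
    rintro _ rfl v; rfl
  exact h4 _ h0 _

/-- Smooth sections of the conormal bundle `E*`. -/
abbrev ConormalSection (i : EmbeddedSubmanifold k m S M) : Type _ :=
  Cₛ^∞⟮𝓡 k; EuclideanSpace ℝ (Fin (m - k)) →L[ℝ] ℝ, fun q : S => i.Normal q →L[ℝ] ℝ⟯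

noncomputable instance (i : EmbeddedSubmanifold k m S M) :
    Module C^∞⟮𝓡 k, S; ℝ⟯ i.ConormalSection where
  smul f η := ⟨fun q => f q • η q, f.contMDiff.smul_section η.contMDiff⟩
  one_smul η := by ext q : 1; exact one_smul ℝ (η q)
  mul_smul f g η := by ext q : 1; exact mul_smul (f q) (g q) (η q)
  smul_zero f := by ext q : 1; exact smul_zero (f q)
  smul_add f η θ := by ext q : 1; exact smul_add (f q) (η q) (θ q)
  add_smul f g η := by ext q : 1; exact add_smul (f q) (g q) (η q)
  zero_smul η := by ext q : 1; exact zero_smul ℝ (η q)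

noncomputable instance (i : EmbeddedSubmanifold k m S M) :
    Module (C^∞⟮𝓡 k, S; ℝ⟯)ᵐᵒᵖ i.ConormalSection :=
  Module.compHom _ ((RingHom.id C^∞⟮𝓡 k, S; ℝ⟯).fromOpposite mul_comm)

instance (i : EmbeddedSubmanifold k m S M) :
    IsCentralScalar C^∞⟮𝓡 k, S; ℝ⟯ i.ConormalSection := ⟨fun _ _ => rfl⟩

instance (i : EmbeddedSubmanifold k m S M) :
    IsScalarTower ℝ C^∞⟮𝓡 k, S; ℝ⟯ i.ConormalSection where
  smul_assoc c f η := by ext q : 1; exact smul_assoc c (f q) (η q)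

instance (i : EmbeddedSubmanifold k m S M) :
    IsScalarTower ℝ (C^∞⟮𝓡 k, S; ℝ⟯)ᵐᵒᵖ i.ConormalSection where
  smul_assoc c f η := smul_assoc c f.unop η

/-- The commutative algebra `C^∞_aff(E) = C^∞(S) ⊕ Γ(E*)` with the infinitesimal multiplication
`(f₁ ⊕ η₁) · (f₂ ⊕ η₂) = f₁f₂ ⊕ (f₁η₂ + f₂η₁)`. -/
abbrev Affine (i : EmbeddedSubmanifold k m S M) : Type _ :=
  TrivSqZeroExt C^∞⟮𝓡 k, S; ℝ⟯ i.ConormalSection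

/-- The fiberwise affine function `π*f + ℓ_η` on `E` represented by `f ⊕ η`. -/
noncomputable def eval (φ : i.Affine) (z : i.Total) : ℝ := φ.fst z.proj + φ.snd z.proj z.snd

/-- The linearization map `Aff : C^∞(E) → C^∞_aff(E)`, `Aff(F) = f ⊕ η`, where `f` is the
restriction of `F` to the zero section and `η_q` is the restriction of `dF` at `0_q` to
`E_q ⊆ T_{0_q}E = T_qS ⊕ E_q`. -/
noncomputable def aff (F : i.SmoothTotal) : i.Affine :=
  (⟨fun q => F (i.zero q), F.contMDiff.comp (contMDiff_zeroSection ℝ i.Normal)⟩,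
   ⟨fun q => ContinuousLinearMap.comp
      (mfderiv (totalModel k m) 𝓘(ℝ) F (i.zero q) :
        TangentSpace (totalModel k m) (i.zero q) →L[ℝ] ℝ) (i.vert q), by
    intro q₀
    rw [contMDiffAt_hom_bundle]
    refine ⟨contMDiffAt_id, ?_⟩
    let t := trivializationAt (EuclideanSpace ℝ (Fin (m - k))) i.Normal q₀
    have ht : q₀ ∈ t.baseSet := FiberBundle.mem_baseSet_trivializationAt' q₀
    have h1 : ContMDiffAt ((𝓡 k).prod 𝓘(ℝ, EuclideanSpace ℝ (Fin (m - k)))) 𝓘(ℝ) ∞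
        (Function.uncurry fun q w => F (t.toOpenPartialHomeomorph.symm (q, w))) (q₀, 0) := by
      have h2 := (t.contMDiffOn_symm (n := ∞) (IB := 𝓡 k)).contMDiffAt
        (t.open_target.mem_nhds (x := (q₀, 0)) (by simpa [t.target_eq] using ht))
      exact F.contMDiff.contMDiffAt.comp _ h2
    have h3 := ContMDiffAt.mfderiv (m := ∞) (x₀ := q₀)
      (fun q w => F (t.toOpenPartialHomeomorph.symm (q, w))) (fun _ => 0) h1
      contMDiffAt_const (by simp)
    have h4 : ContMDiffAt (𝓡 k) 𝓘(ℝ, EuclideanSpace ℝ (Fin (m - k)) →L[ℝ] ℝ) ∞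
        (fun q => fderiv ℝ (fun w : EuclideanSpace ℝ (Fin (m - k)) =>
          F (t.toOpenPartialHomeomorph.symm (q, w))) 0) q₀ := by
      refine h3.congr_of_eventuallyEq (Filter.Eventually.of_forall fun q => ?_)
      exact mfderiv_eq_fderiv.symm.trans (congrFun (inTangentCoordinates_model_space (I := 𝓘(ℝ, EuclideanSpace ℝ (Fin (m - k))))
        (I' := 𝓘(ℝ)) (fun _ : S => (0 : EuclideanSpace ℝ (Fin (m - k))))
        (fun x => F (t.toOpenPartialHomeomorph.symm (x, 0)))
        (fun x => by
          exact mfderiv 𝓘(ℝ, EuclideanSpace ℝ (Fin (m - k))) 𝓘(ℝ)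
            (fun w => F (t.toOpenPartialHomeomorph.symm (x, w))) 0) q₀) q).symm
    refine h4.congr_of_eventuallyEq ?_
    filter_upwards [t.open_baseSet.mem_nhds ht] with q hq
    ext w
    simp only [ContinuousLinearMap.inCoordinates, ContinuousLinearMap.comp_apply]
    erw [Bundle.Trivial.continuousLinearMapAt_trivialization]
    refine (i.vert_symmL q t F w).trans ?_
    have h5 : (fun w => F ⟨q, t.symmL ℝ q w⟩) =
        fun w => F (t.toOpenPartialHomeomorph.symm (q, w)) := by
      funext w
      rw [Trivialization.symmL_apply _ hq, t.mk_symm hq]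
    rw [h5]⟩)

/-- `R = O₂`: the function `R` vanishes to second order along the zero section. -/
def IsO2 (R : i.SmoothTotal) : Prop :=
  ∀ q : S, R (i.zero q) = 0 ∧ mfderiv (totalModel k m) 𝓘(ℝ) R (i.zero q) = 0

/-- `θ = [η₁, η₂]_{E*}`, the bracket induced from the restricted cotangent Lie algebroid `A_S`
through `ν* : E* ≅ TS° ⊆ T*_SM`. The bracket of `A_S` is the one for which restriction of one-forms
from `M` to `S` is a homomorphism, so its value at `q` is computed from any one-forms on `M` which
restrict to `ν*η₁`, `ν*η₂` along `S` near `q` (these always exist, by a cut-off). -/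
def IsConormalBracket (i : EmbeddedSubmanifold k m S M) (B : Bivector m M)
    (η₁ η₂ θ : i.ConormalSection) : Prop :=
  ∀ (q : S) (α₁ α₂ : OneForm m M),
    (∀ᶠ p in 𝓝 q, α₁ (i.incl p) = (η₁ p).comp (i.nu p)) →
    (∀ᶠ p in 𝓝 q, α₂ (i.incl p) = (η₂ p).comp (i.nu p)) →
    (θ q).comp (i.nu q) = B.formBracketAt α₁ α₂ (i.incl q)

/-- An infinitesimal Poisson algebra of the Poisson submanifold `S`: a Poisson bracket on the
commutative algebra `C^∞_aff(E)` such that (a) the projection `f ⊕ η ↦ f` onto `C^∞(S)`, which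
preserves products by definition, also preserves the brackets (`fst_bracket`), and (b) on fiberwise
linear functions the bracket is the intrinsic one,
`{0 ⊕ η₁, 0 ⊕ η₂} = 0 ⊕ [η₁, η₂]_{E*}` (`bracket_inr`). -/
structure InfinitesimalPoissonAlgebra (h : i.IsPoisson B) where
  bracket : i.Affine →ₗ[ℝ] i.Affine →ₗ[ℝ] i.Affine
  bracket_self : ∀ φ, bracket φ φ = 0
  jacobi : ∀ φ₁ φ₂ φ₃, bracket φ₁ (bracket φ₂ φ₃) + bracket φ₂ (bracket φ₃ φ₁)
    + bracket φ₃ (bracket φ₁ φ₂) = 0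
  leibniz : ∀ φ₁ φ₂ φ₃, bracket φ₁ (φ₂ * φ₃) = bracket φ₁ φ₂ * φ₃ + φ₂ * bracket φ₁ φ₃
  fst_bracket : ∀ (φ₁ φ₂ : i.Affine) (q : S),
    (bracket φ₁ φ₂).fst q = h.bracketAt φ₁.fst φ₂.fst q
  bracket_inr : ∀ η₁ η₂ : i.ConormalSection, ∃ θ, i.IsConormalBracket B η₁ η₂ θ ∧
    bracket (TrivSqZeroExt.inr η₁) (TrivSqZeroExt.inr η₂) = TrivSqZeroExt.inr θ

/-- An exponential map: a diffeomorphism `e` of `E` onto an open neighborhood of `S` in `M`, which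
is the identity on `S` and such that `E_q ↪ T_{0_q}E → T_qM → E_q` (the middle arrow being the
differential of `e`, the last one `ν_q`) is the identity. -/
structure ExponentialMap (i : EmbeddedSubmanifold k m S M) where
  toHomeo : OpenPartialHomeomorph i.Total M
  source_eq : toHomeo.source = univ
  contMDiff : ContMDiff (totalModel k m) (𝓡 m) ∞ toHomeo
  contMDiffOn_symm : ContMDiffOn (𝓡 m) (totalModel k m) ∞ toHomeo.symm toHomeo.target
  map_zero : ∀ q : S, toHomeo (i.zero q) = i.incl q
  normal : ∀ (q : S) (v : i.Normal q),
    i.nu q (mfderiv (totalModel k m) (𝓡 m) toHomeo (i.zero q) (i.vert q v)) = v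

/-- The pull-back `e* : C^∞(M) → C^∞(E)`. -/
noncomputable def ExponentialMap.pullback (e : i.ExponentialMap) (H : C^∞⟮𝓡 m, M; ℝ⟯) : i.SmoothTotal :=
  ⟨fun z => H (e.toHomeo z), H.contMDiff.comp e.contMDiff⟩

/-- `{φ₁ ∘ e⁻¹, φ₂ ∘ e⁻¹}_M ∘ e = {φ₁, φ₂}^aff + O₂` for all `φ₁, φ₂ ∈ C^∞_aff(E)`. -/
def IsFirstOrderApproximation {h : i.IsPoisson B} (e : i.ExponentialMap)
    (P : InfinitesimalPoissonAlgebra h) : Prop :=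
  ∀ φ₁ φ₂ : i.Affine, ∃ R : i.SmoothTotal, IsO2 R ∧ ∀ z : i.Total,
    B.bracketAt (fun x => eval φ₁ (e.toHomeo.symm x)) (fun x => eval φ₂ (e.toHomeo.symm x))
      (e.toHomeo z) = eval (P.bracket φ₁ φ₂) z + R z

/-- `Aff ∘ e* : C^∞(M) → C^∞_aff(E)` is a homomorphism of Poisson algebras. -/
def AffIsPoissonHom {h : i.IsPoisson B} (e : i.ExponentialMap)
    (P : InfinitesimalPoissonAlgebra h) : Prop :=
  ∃ Φ : C^∞⟮𝓡 m, M; ℝ⟯ →ₐ[ℝ] i.Affine,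
    (∀ H, Φ H = aff (e.pullback H)) ∧ ∀ H G, Φ (B.bracket H G) = P.bracket (Φ H) (Φ G)

end EmbeddedSubmanifold

open EmbeddedSubmanifold

/-! The exponential map carries `{·,·}_M` to a Poisson bracket on `C^∞(E)`, called `totalBracket`.
Linearization is an algebra homomorphism from `C^∞(E)` onto `C^∞_aff(E)`, split by the inclusion of
the affine functions (`aff_evalMap`), and its kernel consists exactly of the functions `O₂`
(`isO2_iff_aff_eq_zero`). Everything rests on this kernel being a Poisson ideal
(`aff_totalBracket_eq_zero`): the bracket then descends to `C^∞_aff(E)`, where it becomes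
`affineBracket` and inherits the Jacobi and Leibniz identities.

The ideal property comes from tangency. Suppose `dg = 0` along `S`, and put `X_f = Π♯ df`, so that
`{f, g} = dg(X_f)`. At `q ∈ S`, the number `d{f, g}(v)` is the sum of `dg_q` applied to a derivative
of `X_f`, which is zero, and of the second derivative of `g` in the directions `v` and `X_f`. By
symmetry the latter is the derivative of `dg` in the direction `X_f`. This direction is tangent to
`S` because `S` is Poisson, and `dg` vanishes along `S`; see `IsPoisson.dAt_bracket_eq_zero`.

Tangency also gives (a). For (b), `Π♯` kills conormal covectors, so at a point of `S` the bracket of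
two forms `α`, `β` with conormal values reduces to `-d⟨α, Π♯ β⟩`. This depends only on the values of
the forms at that point, hence `α` and `β` may be replaced by exact forms `df`, `dg`, which gives
`d{f, g}` (`IsPoisson.formBracketAt_eq_dAt`).

Finally, each of the two conditions compared in the theorem says that the bracket is
`affineBracket`. For `(*)`, apply linearization to both sides. For the homomorphism property,
brackets of linearized pull-backs are prescribed; the Leibniz rule makes any infinitesimal Poisson
bracket local (`bracket_congr`), and every affine function agrees near a given `0_q` with a
pull-back from `M`. -/

section Poisson

variable {d : ℕ} {N : Type*} [TopologicalSpace N] [ChartedSpace (EuclideanSpace ℝ (Fin d)) N]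

/-! ### Differential calculus of functions, one-forms and bivectors -/

theorem dAt_congr {f g : N → ℝ} {x : N} (h : f =ᶠ[𝓝 x] g) : dAt (d := d) f x = dAt g x :=
  h.mfderiv_eq

theorem dAt_add {f g : N → ℝ} {x : N} (hf : MDifferentiableAt (𝓡 d) 𝓘(ℝ) f x)
    (hg : MDifferentiableAt (𝓡 d) 𝓘(ℝ) g x) :
    dAt (d := d) (fun y => f y + g y) x = dAt f x + dAt g x :=
  (hf.hasMFDerivAt.add hg.hasMFDerivAt).mfderiv

theorem dAt_const_mul {f : N → ℝ} {x : N} (c : ℝ) (hf : MDifferentiableAt (𝓡 d) 𝓘(ℝ) f x) :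
    dAt (d := d) (fun y => c * f y) x = c • dAt f x :=
  (hf.hasMFDerivAt.const_smul c).mfderiv

theorem dAt_mul {f g : N → ℝ} {x : N} (hf : MDifferentiableAt (𝓡 d) 𝓘(ℝ) f x)
    (hg : MDifferentiableAt (𝓡 d) 𝓘(ℝ) g x) :
    dAt (d := d) (fun y => f y * g y) x = f x • dAt g x + g x • dAt f x :=
  (hf.hasMFDerivAt.mul hg.hasMFDerivAt).mfderiv

/-- The product rule for the pairing of a function with values in linear maps with a function
with values in vectors. -/
theorem HasMFDerivAt.clm_apply_real {F : Type*} [NormedAddCommGroup F] [NormedSpace ℝ F]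
    {A : N → F →L[ℝ] ℝ} {Y : N → F} {x : N}
    {A' : EuclideanSpace ℝ (Fin d) →L[ℝ] F →L[ℝ] ℝ} {Y' : EuclideanSpace ℝ (Fin d) →L[ℝ] F}
    (hA : HasMFDerivAt (𝓡 d) 𝓘(ℝ, F →L[ℝ] ℝ) A x A') (hY : HasMFDerivAt (𝓡 d) 𝓘(ℝ, F) Y x Y') :
    HasMFDerivAt (𝓡 d) 𝓘(ℝ) (fun y => A y (Y y)) x ((A x).comp Y' + A'.flip (Y x)) := by
  have h := HasFDerivWithinAt.clm_apply hA.2 hY.2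
  refine ⟨?_, ?_⟩
  · exact hA.1.clm_apply hY.1
  · have e1 : writtenInExtChartAt (𝓡 d) 𝓘(ℝ, F →L[ℝ] ℝ) x A (extChartAt (𝓡 d) x x) = A x := by
      simp only [writtenInExtChartAt, mfld_simps]; rfl
    have e2 : writtenInExtChartAt (𝓡 d) 𝓘(ℝ, F) x Y (extChartAt (𝓡 d) x x) = Y x := by
      simp only [writtenInExtChartAt, mfld_simps]; rfl
    rw [e1, e2] at h
    exact h

variable [IsManifold (𝓡 d) ∞ N]

/-- A cotangent vector at `y` read in the tangent bundle trivialization at `x`. -/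
noncomputable def covectorCoord (x y : N) (α : TangentSpace (𝓡 d) y →L[ℝ] ℝ) :
    EuclideanSpace ℝ (Fin d) →L[ℝ] ℝ :=
  α.comp ((trivializationAt (EuclideanSpace ℝ (Fin d)) (TangentSpace (𝓡 d)) x).symmL ℝ y)

/-- A tangent vector at `y` read in the tangent bundle trivialization at `x`. -/
noncomputable def vectorCoord (x y : N) :
    TangentSpace (𝓡 d) y →L[ℝ] EuclideanSpace ℝ (Fin d) :=
  (trivializationAt (EuclideanSpace ℝ (Fin d)) (TangentSpace (𝓡 d)) x).continuousLinearMapAt ℝ y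

theorem covectorCoord_vectorCoord {x y : N}
    (hy : y ∈ (chartAt (EuclideanSpace ℝ (Fin d)) x).source)
    (α : TangentSpace (𝓡 d) y →L[ℝ] ℝ) (v : TangentSpace (𝓡 d) y) :
    covectorCoord x y α (vectorCoord x y v) = α v := by
  simp only [covectorCoord, vectorCoord, ContinuousLinearMap.comp_apply]
  rw [Trivialization.symmL_continuousLinearMapAt _ (by exact hy)]

theorem OneForm.mdifferentiableAt_coord (α : OneForm d N) (x : N) :
    MDifferentiableAt (𝓡 d) 𝓘(ℝ, EuclideanSpace ℝ (Fin d) →L[ℝ] ℝ)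
      (fun y => covectorCoord x y (α y)) x := by
  have h := ((contMDiffAt_hom_bundle _).1 (α.contMDiff x)).2.mdifferentiableAt (by simp)
  refine h.congr_of_eventuallyEq (Eventually.of_forall fun y => ?_)
  ext v
  simp only [ContinuousLinearMap.inCoordinates, ContinuousLinearMap.comp_apply]
  erw [Bundle.Trivial.continuousLinearMapAt_trivialization]
  rfl

variable (B : Bivector d N)

theorem Bivector.mdifferentiableAt_coord_sharp (α : OneForm d N) (x : N) :
    MDifferentiableAt (𝓡 d) 𝓘(ℝ, EuclideanSpace ℝ (Fin d))
      (fun y => vectorCoord x y (B.sharp y (α y))) x := by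
  have h1 := ContMDiff.clm_bundle_apply (b := id) B.sharp.contMDiff α.contMDiff
  have h := ((contMDiffAt_section _).1 (h1 x)).mdifferentiableAt (by simp)
  refine h.congr_of_eventuallyEq ?_
  filter_upwards [(chartAt (EuclideanSpace ℝ (Fin d)) x).open_source.mem_nhds
    (mem_chart_source _ x)] with y hy
  rw [vectorCoord, Trivialization.continuousLinearMapAt_apply,
    Trivialization.linearMapAt_apply, if_pos (by exact hy)]

theorem Bivector.contMDiff_pairing (α β : OneForm d N) :
    ContMDiff (𝓡 d) 𝓘(ℝ) ∞ (fun y => α y (B.sharp y (β y))) := by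
  have h1 := ContMDiff.clm_bundle_apply (b := id) B.sharp.contMDiff β.contMDiff
  have h2 := ContMDiff.clm_bundle_apply (b := id) (E₂ := Bundle.Trivial N ℝ) α.contMDiff h1
  intro x
  exact (contMDiffAt_totalSpace.1 (h2 x)).2

/-- The derivative of a one-form read in the trivialization at `x`. -/
noncomputable def OneForm.coordDeriv (α : OneForm d N) (x : N) :
    EuclideanSpace ℝ (Fin d) →L[ℝ] EuclideanSpace ℝ (Fin d) →L[ℝ] ℝ :=
  let D : EuclideanSpace ℝ (Fin d) →L[ℝ] EuclideanSpace ℝ (Fin d) →L[ℝ] ℝ :=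
    mfderiv (𝓡 d) 𝓘(ℝ, EuclideanSpace ℝ (Fin d) →L[ℝ] ℝ) (fun y => covectorCoord x y (α y)) x
  D

theorem OneForm.hasMFDerivAt_coord (α : OneForm d N) (x : N) :
    HasMFDerivAt (𝓡 d) 𝓘(ℝ, EuclideanSpace ℝ (Fin d) →L[ℝ] ℝ)
      (fun y => covectorCoord x y (α y)) x (α.coordDeriv x) :=
  (α.mdifferentiableAt_coord x).hasMFDerivAt

/-- The product rule in the tangent trivialization at `x`. The derivative `Y'` of the vector field
`Π♯ β` stays unspecified because it is only used where `α x = 0`, so that its term drops out. -/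
theorem Bivector.exists_dAt_pairing (α β : OneForm d N) (x : N) :
    ∃ Y' : EuclideanSpace ℝ (Fin d) →L[ℝ] EuclideanSpace ℝ (Fin d),
      ∀ v : TangentSpace (𝓡 d) x, dAt (d := d) (fun y => α y (B.sharp y (β y))) x v =
        covectorCoord x x (α x) (Y' v) +
          α.coordDeriv x v (vectorCoord x x (B.sharp x (β x))) := by
  have h := (α.hasMFDerivAt_coord x).clm_apply_real
    (B.mdifferentiableAt_coord_sharp β x).hasMFDerivAt
  refine ⟨_, fun v => DFunLike.congr_fun (h.congr_of_eventuallyEq ?_).mfderiv v⟩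
  filter_upwards [(chartAt (EuclideanSpace ℝ (Fin d)) x).open_source.mem_nhds
    (mem_chart_source _ x)] with y hy
  exact (covectorCoord_vectorCoord hy _ _).symm

/-- Both factors of the pairing vanish at `x`, hence both terms of the product rule do. -/
theorem Bivector.dAt_pairing_eq_zero {α β : OneForm d N} {x : N} (hα : α x = 0)
    (hβ : B.sharp x (β x) = 0) : dAt (d := d) (fun y => α y (B.sharp y (β y))) x = 0 := by
  obtain ⟨Y', h⟩ := B.exists_dAt_pairing α β x
  ext v
  rw [h, hα, hβ, map_zero, map_zero, add_zero]
  rfl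

theorem Bivector.skew (x : N) (α β : TangentSpace (𝓡 d) x →L[ℝ] ℝ) :
    α (B.sharp x β) = -β (B.sharp x α) := by
  have h := B.alternating x (α + β)
  simp only [map_add, add_apply, B.alternating] at h
  linarith

/-- At a point where `Π♯` kills `α₁` and `α₂`, the differential of `⟨α₁, Π♯ α₂⟩` only depends on
the values of the forms at this point. -/
theorem Bivector.dAt_pairing_congr {α₁ α₂ β₁ β₂ : OneForm d N} {x : N} (h₁ : α₁ x = β₁ x)
    (h₂ : α₂ x = β₂ x) (hs₁ : B.sharp x (α₁ x) = 0) (hs₂ : B.sharp x (α₂ x) = 0) :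
    dAt (d := d) (fun y => α₁ y (B.sharp y (α₂ y))) x = dAt (d := d) (fun y => β₁ y (B.sharp y (β₂ y))) x := by
  have md : ∀ α β : OneForm d N,
      MDifferentiableAt (𝓡 d) 𝓘(ℝ) (fun y => α y (B.sharp y (β y))) x :=
    fun α β => (B.contMDiff_pairing α β).mdifferentiableAt (by simp)
  have e1 : dAt (d := d) (fun y => (α₁ - β₁) y (B.sharp y (α₂ y))) x = 0 :=
    B.dAt_pairing_eq_zero (by simp [h₁]) hs₂
  have e2 : dAt (d := d) (fun y => (α₂ - β₂) y (B.sharp y (β₁ y))) x = 0 :=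
    B.dAt_pairing_eq_zero (by simp [h₂]) (by rw [← h₁]; exact hs₁)
  -- Telescoping: change `α₁` into `β₁`, then `α₂` into `β₂`. Skew-symmetry moves `α₂ - β₂` to the
  -- outer slot, so that in each correction the outer form vanishes at `x`, and so does the vector
  -- to which it is applied.
  have e3 : (fun y => α₁ y (B.sharp y (α₂ y))) = fun y =>
      β₁ y (B.sharp y (β₂ y)) + ((α₁ - β₁) y (B.sharp y (α₂ y)) +
        (-1) * (α₂ - β₂) y (B.sharp y (β₁ y))) := by
    funext y
    have := B.skew y (β₁ y) (α₂ y - β₂ y)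
    simp only [ContMDiffSection.coe_sub, Pi.sub_apply, sub_apply, map_sub]
      at this ⊢
    linarith
  have m1 : MDifferentiableAt (𝓡 d) 𝓘(ℝ)
      (fun y => (-1) * (α₂ - β₂) y (B.sharp y (β₁ y))) x := (md _ _).const_smul (-1 : ℝ)
  have m2 : MDifferentiableAt (𝓡 d) 𝓘(ℝ) (fun y => (α₁ - β₁) y (B.sharp y (α₂ y)) +
      (-1) * (α₂ - β₂) y (B.sharp y (β₁ y))) x := (md _ _).add m1
  rw [e3, dAt_add (md _ _) m2, dAt_add (md _ _) m1, dAt_const_mul _ (md _ _), e1, e2]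
  simp

/-- The tangent trivialization at `x` is the differential of the chart at `x`, so this is the chain
rule for `f` composed with the inverse chart. It reduces derivatives of `df` to second derivatives
on the model space. -/
theorem covectorCoord_dAt {x y : N} (f : C^∞⟮𝓡 d, N; ℝ⟯)
    (hy : y ∈ (chartAt (EuclideanSpace ℝ (Fin d)) x).source) :
    covectorCoord x y (dAt f y) =
      fderiv ℝ (f ∘ (extChartAt (𝓡 d) x).symm) (extChartAt (𝓡 d) x y) := by
  have : IsManifold (𝓡 d) 1 N := IsManifold.of_le (n := ∞) (by simp)
  have hy' : extChartAt (𝓡 d) x y ∈ (extChartAt (𝓡 d) x).target :=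
    (extChartAt (𝓡 d) x).map_source (by simpa using hy)
  have e := (extChartAt (𝓡 d) x).left_inv (x := y) (by simpa using hy)
  have hs : MDifferentiableAt 𝓘(ℝ, EuclideanSpace ℝ (Fin d)) (𝓡 d) (extChartAt (𝓡 d) x).symm
      (extChartAt (𝓡 d) x y) :=
    ((contMDiffOn_extChartAt_symm (n := ∞) x).contMDiffAt
      ((isOpen_extChartAt_target x).mem_nhds hy')).mdifferentiableAt (by simp)
  have h := mfderiv_comp (I'' := 𝓘(ℝ)) (g := f) (extChartAt (𝓡 d) x y)
    (f.contMDiff.mdifferentiableAt (by simp)) hs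
  rw [← mfderiv_eq_fderiv, h, covectorCoord, TangentBundle.symmL_trivializationAt hy]
  simp only [ModelWithCorners.range_eq_univ, mfderivWithin_univ, dAt]
  ext v
  exact congrArg (fun z => (mfderiv (𝓡 d) 𝓘(ℝ) f z : EuclideanSpace ℝ (Fin d) → ℝ)
    (mfderiv 𝓘(ℝ, EuclideanSpace ℝ (Fin d)) (𝓡 d) (extChartAt (𝓡 d) x).symm
      (extChartAt (𝓡 d) x y) v)) e.symm

/-- The symmetry of second derivatives: the derivative of `df`, in a chart, is symmetric. -/
theorem coordDeriv_differential_symm (f : C^∞⟮𝓡 d, N; ℝ⟯) (x : N)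
    (u v : TangentSpace (𝓡 d) x) :
    (differential f).coordDeriv x u (vectorCoord x x v) =
      (differential f).coordDeriv x v (vectorCoord x x u) := by
  have : IsManifold (𝓡 d) 1 N := IsManifold.of_le (n := ∞) (by simp)
  have hx : x ∈ (chartAt (EuclideanSpace ℝ (Fin d)) x).source := mem_chart_source _ x
  have hcd : ContDiffAt ℝ ∞ (f ∘ (extChartAt (𝓡 d) x).symm) (extChartAt (𝓡 d) x x) := by
    rw [← contMDiffAt_iff_contDiffAt]
    exact f.contMDiff.contMDiffAt.comp _ ((contMDiffOn_extChartAt_symm (n := ∞) x).contMDiffAt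
      (extChartAt_target_mem_nhds x))
  have hev : (fun y => covectorCoord x y (dAt f y)) =ᶠ[𝓝 x]
      fderiv ℝ (f ∘ (extChartAt (𝓡 d) x).symm) ∘ extChartAt (𝓡 d) x := by
    filter_upwards [(chartAt (EuclideanSpace ℝ (Fin d)) x).open_source.mem_nhds hx] with y hy
    exact covectorCoord_dAt f hy
  have hd : DifferentiableAt ℝ (fderiv ℝ (f ∘ (extChartAt (𝓡 d) x).symm))
      (extChartAt (𝓡 d) x x) :=
    (hcd.fderiv_right (m := ∞) (by simp)).differentiableAt (by simp)
  have hc : MDifferentiableAt (𝓡 d) 𝓘(ℝ, EuclideanSpace ℝ (Fin d)) (extChartAt (𝓡 d) x) x :=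
    mdifferentiableAt_extChartAt hx
  -- Chain rule again: the differential of the chart at `x` is the vector coordinate, so the
  -- derivative of `df` is the ordinary second derivative, which is symmetric.
  have key : ∀ w : TangentSpace (𝓡 d) x, (differential f).coordDeriv x w =
      fderiv ℝ (fderiv ℝ (f ∘ (extChartAt (𝓡 d) x).symm)) (extChartAt (𝓡 d) x x)
        (vectorCoord x x w) := by
    intro w
    have h := (hd.mdifferentiableAt.hasMFDerivAt.comp x hc.hasMFDerivAt).congr_of_eventuallyEq hev
    rw [← mfderiv_eq_fderiv, vectorCoord,
      TangentBundle.continuousLinearMapAt_trivializationAt hx]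
    exact DFunLike.congr_fun h.mfderiv w
  rw [key, key]
  exact (hcd.isSymmSndFDerivAt (by simp; exact WithTop.coe_le_coe.2 le_top)).eq _ _

/-- Smooth functions on a neighborhood of `x` extend, as germs, to the manifold. -/
theorem exists_contMDiffMap_eventuallyEq [T2Space N] {f : N → ℝ} {x : N}
    (hf : ∀ᶠ y in 𝓝 x, ContMDiffAt (𝓡 d) 𝓘(ℝ) ∞ f y) :
    ∃ g : C^∞⟮𝓡 d, N; ℝ⟯, g =ᶠ[𝓝 x] f := by
  obtain ⟨ρ, -, hρ⟩ := (SmoothBumpFunction.nhds_basis_tsupport (I := 𝓡 d) x).mem_iff.1 hf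
  refine ⟨⟨fun y => ρ y • f y, contMDiff_of_tsupport fun y hy => ?_⟩, ?_⟩
  · exact ρ.contMDiffAt.smul (hρ (tsupport_smul_subset_left _ _ hy))
  · filter_upwards [ρ.eventuallyEq_one] with y hy
    change ρ y • f y = f y
    rw [hy]; simp

end Poisson

/-! ### Locality of the bracket of a bivector -/

section Poisson

variable {d : ℕ} {N : Type*} [TopologicalSpace N] [ChartedSpace (EuclideanSpace ℝ (Fin d)) N]
  [IsManifold (𝓡 d) ∞ N] (B : Bivector d N)

theorem Bivector.bracketAt_congr {f f' g g' : N → ℝ} {x : N} (hf : f =ᶠ[𝓝 x] f')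
    (hg : g =ᶠ[𝓝 x] g') : B.bracketAt f g x = B.bracketAt f' g' x := by
  rw [bracketAt, dAt_congr hf, dAt_congr hg, bracketAt]

theorem Bivector.bracketAt_eventuallyEq {f f' g g' : N → ℝ} {x : N} (hf : f =ᶠ[𝓝 x] f')
    (hg : g =ᶠ[𝓝 x] g') : B.bracketAt f g =ᶠ[𝓝 x] B.bracketAt f' g' := by
  filter_upwards [hf.eventuallyEq_nhds, hg.eventuallyEq_nhds] with y h1 h2
  exact B.bracketAt_congr h1 h2

end Poisson

/-! ### Brackets along a Poisson submanifold -/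

namespace EmbeddedSubmanifold

variable {k m : ℕ} {S M : Type*}
  [TopologicalSpace S] [ChartedSpace (EuclideanSpace ℝ (Fin k)) S] [IsManifold (𝓡 k) ∞ S]
  [TopologicalSpace M] [ChartedSpace (EuclideanSpace ℝ (Fin m)) M] [IsManifold (𝓡 m) ∞ M]

variable {i : EmbeddedSubmanifold k m S M} {B : Bivector m M}

theorem IsPoisson.sharp_eq (h : i.IsPoisson B) (q : S)
    (β : TangentSpace (𝓡 m) (i.incl q) →L[ℝ] ℝ) :
    B.sharp (i.incl q) β = i.diff q (h.inducedSharp q (β.comp (i.diff q))) :=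
  (h q).choose_spec.2 β

theorem IsPoisson.sharp_eq_zero (h : i.IsPoisson B) {q : S}
    {β : TangentSpace (𝓡 m) (i.incl q) →L[ℝ] ℝ} (hβ : β.comp (i.diff q) = 0) :
    B.sharp (i.incl q) β = 0 := by
  rw [h.sharp_eq, hβ, map_zero, map_zero]

theorem nu_diff (i : EmbeddedSubmanifold k m S M) (q : S) (u : TangentSpace (𝓡 k) q) :
    i.nu q (i.diff q u) = 0 :=
  (Submodule.Quotient.mk_eq_zero _).2 ⟨u, rfl⟩

theorem exists_diff_of_nu_eq_zero {q : S} {v : TangentSpace (𝓡 m) (i.incl q)}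
    (hv : i.nu q v = 0) : ∃ u, i.diff q u = v :=
  (Submodule.Quotient.mk_eq_zero _).1 hv

theorem dAt_comp_incl (i : EmbeddedSubmanifold k m S M) {f : M → ℝ} {q : S}
    (hf : MDifferentiableAt (𝓡 m) 𝓘(ℝ) f (i.incl q)) :
    dAt (d := k) (fun p => f (i.incl p)) q = (dAt f (i.incl q)).comp (i.diff q) :=
  mfderiv_comp q hf (i.contMDiff.mdifferentiableAt (by simp))

/-- Hamiltonian vectors at points of `S` come from `T_qS`, so only the restrictions to `S` of the
two differentials enter. This is the source of condition (a). -/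
theorem IsPoisson.bracketAt_incl (h : i.IsPoisson B) {f g : M → ℝ} {q : S}
    (hf : MDifferentiableAt (𝓡 m) 𝓘(ℝ) f (i.incl q))
    (hg : MDifferentiableAt (𝓡 m) 𝓘(ℝ) g (i.incl q)) :
    B.bracketAt f g (i.incl q) =
      h.bracketAt (fun p => f (i.incl p)) (fun p => g (i.incl p)) q := by
  rw [Bivector.bracketAt, IsPoisson.bracketAt, i.dAt_comp_incl hf, i.dAt_comp_incl hg, h.sharp_eq]
  rfl

/-- The bracket with a function which vanishes to second order along `S` vanishes to second order
along `S`. -/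
theorem IsPoisson.dAt_bracket_eq_zero (h : i.IsPoisson B) (f g : C^∞⟮𝓡 m, M; ℝ⟯) {q : S}
    (hg : ∀ᶠ p in 𝓝 q, dAt (d := m) g (i.incl p) = 0) :
    dAt (d := m) (B.bracketAt f g) (i.incl q) = 0 := by
  obtain ⟨Y', hY⟩ := B.exists_dAt_pairing (differential g) (differential f) (i.incl q)
  have h0 : differential g (i.incl q) = 0 := hg.self_of_nhds
  ext v
  refine (hY v).trans ?_
  -- The surviving term is the second derivative of `g` along `v` and the Hamiltonian vector of `f`.
  -- Symmetry puts the Hamiltonian vector, which is tangent to `S`, in the slot of differentiation.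
  rw [h0, h.sharp_eq, coordDeriv_differential_symm]
  set u := h.inducedSharp q ((differential f (i.incl q)).comp (i.diff q))
  have hc := ((differential g).hasMFDerivAt_coord (i.incl q)).comp q
    (i.contMDiff.mdifferentiableAt (by simp)).hasMFDerivAt
  -- Along `S` the form `dg` is identically zero near `q`, so its derivative in directions tangent
  -- to `S` is zero.
  have hz : (fun y => covectorCoord (i.incl q) y (differential g y)) ∘ i.incl =ᶠ[𝓝 q]
      fun _ => (0 : EuclideanSpace ℝ (Fin m) →L[ℝ] ℝ) := by
    filter_upwards [hg] with p hp
    have : differential g (i.incl p) = 0 := hp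
    simp only [Function.comp_apply, this]
    rfl
  have hd : (differential g).coordDeriv (i.incl q) (i.diff q u) = 0 := by
    have := (hc.mfderiv.symm.trans hz.mfderiv_eq).trans mfderiv_const
    exact DFunLike.congr_fun this u
  rw [hd]
  simp [covectorCoord]

/-- The two exterior derivatives are contracted with `Π♯ α` and `Π♯ β`, which vanish at `ι q`
because both covectors are conormal there. -/
theorem IsPoisson.formBracketAt_eq (h : i.IsPoisson B) {α β : OneForm m M} {q : S}
    (hα : (α (i.incl q)).comp (i.diff q) = 0) (hβ : (β (i.incl q)).comp (i.diff q) = 0) :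
    B.formBracketAt α β (i.incl q) =
      -dAt (d := m) (fun y => α y (B.sharp y (β y))) (i.incl q) := by
  rw [Bivector.formBracketAt, h.sharp_eq_zero hα, h.sharp_eq_zero hβ, map_zero, map_zero, sub_zero,
    zero_sub]

/-- The bracket of conormal forms is the differential of the bracket of functions with these
differentials. -/
theorem IsPoisson.formBracketAt_eq_dAt (h : i.IsPoisson B) {α β : OneForm m M}
    {f g : C^∞⟮𝓡 m, M; ℝ⟯} {q : S}
    (hα : α (i.incl q) = dAt f (i.incl q)) (hβ : β (i.incl q) = dAt g (i.incl q))
    (hf : (dAt f (i.incl q)).comp (i.diff q) = 0) (hg : (dAt g (i.incl q)).comp (i.diff q) = 0) :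
    B.formBracketAt α β (i.incl q) = dAt (d := m) (B.bracketAt f g) (i.incl q) := by
  have hf' := hα ▸ hf
  have hg' := hβ ▸ hg
  rw [h.formBracketAt_eq hf' hg', B.dAt_pairing_congr (β₁ := differential f)
    (β₂ := differential g) hα hβ (h.sharp_eq_zero hf') (h.sharp_eq_zero hg')]
  have e : B.bracketAt f g = fun y =>
      (-1 : ℝ) * (differential f y (B.sharp y (differential g y))) := by
    funext y
    rw [B.skew, neg_one_mul, neg_neg]
    rfl
  rw [e, dAt_const_mul _ ((B.contMDiff_pairing _ _).mdifferentiableAt (by simp))]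
  exact (neg_one_smul ℝ _).symm

/-! ### The Poisson bracket transported to the normal bundle -/

namespace ExponentialMap

variable (e : i.ExponentialMap)

theorem mem_target (z : i.Total) : e.toHomeo z ∈ e.toHomeo.target :=
  e.toHomeo.map_source (e.source_eq ▸ mem_univ z)

theorem symm_apply (z : i.Total) : e.toHomeo.symm (e.toHomeo z) = z :=
  e.toHomeo.left_inv (e.source_eq ▸ mem_univ z)

theorem symm_incl (q : S) : e.toHomeo.symm (i.incl q) = i.zero q := by
  rw [← e.map_zero, e.symm_apply]

theorem incl_mem_target (q : S) : i.incl q ∈ e.toHomeo.target :=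
  e.map_zero q ▸ e.mem_target _

/-- The function `F ∘ e⁻¹`, defined on the image of the exponential map. -/
noncomputable def push (F : i.SmoothTotal) (x : M) : ℝ := F (e.toHomeo.symm x)

theorem push_apply (F : i.SmoothTotal) (z : i.Total) : e.push F (e.toHomeo z) = F z := by
  rw [push, e.symm_apply]

theorem push_incl (F : i.SmoothTotal) (q : S) : e.push F (i.incl q) = F (i.zero q) := by
  rw [push, e.symm_incl]

theorem contMDiffAt_push (F : i.SmoothTotal) {x : M} (hx : x ∈ e.toHomeo.target) :
    ContMDiffAt (𝓡 m) 𝓘(ℝ) ∞ (e.push F) x :=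
  F.contMDiff.contMDiffAt.comp x
    (e.contMDiffOn_symm.contMDiffAt (e.toHomeo.open_target.mem_nhds hx))

theorem mdifferentiableAt_push (F : i.SmoothTotal) {x : M} (hx : x ∈ e.toHomeo.target) :
    MDifferentiableAt (𝓡 m) 𝓘(ℝ) (e.push F) x :=
  (e.contMDiffAt_push F hx).mdifferentiableAt (by simp)

theorem exists_eventuallyEq_push [T2Space M] (F : i.SmoothTotal) {x : M}
    (hx : x ∈ e.toHomeo.target) : ∃ H : C^∞⟮𝓡 m, M; ℝ⟯, H =ᶠ[𝓝 x] e.push F :=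
  exists_contMDiffMap_eventuallyEq
    (Filter.mem_of_superset (e.toHomeo.open_target.mem_nhds hx) fun _ hy => e.contMDiffAt_push F hy)

theorem push_congr {F G : i.SmoothTotal} {x : M} (hx : x ∈ e.toHomeo.target)
    (h : F =ᶠ[𝓝 (e.toHomeo.symm x)] G) : e.push F =ᶠ[𝓝 x] e.push G :=
  (e.toHomeo.continuousAt_symm hx).eventually h

theorem push_pullback (H : C^∞⟮𝓡 m, M; ℝ⟯) {x : M} (hx : x ∈ e.toHomeo.target) :
    e.push (e.pullback H) =ᶠ[𝓝 x] H := by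
  filter_upwards [e.toHomeo.open_target.mem_nhds hx] with y hy
  exact congrArg H (e.toHomeo.right_inv hy)

/-- The Poisson bracket on `C^∞(E)` obtained from the one on `M` through the exponential map. -/
noncomputable def totalBracket [T2Space M] (B : Bivector m M) (F G : i.SmoothTotal) :
    i.SmoothTotal where
  val z := B.bracketAt (e.push F) (e.push G) (e.toHomeo z)
  property := by
    intro z
    -- The pushed functions are known to be smooth only on the image of `e`. Smoothness of the
    -- bracket is a local matter, so near each point they are replaced by global functions with the
    -- same germs.
    obtain ⟨F', hF⟩ := e.exists_eventuallyEq_push F (e.mem_target z)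
    obtain ⟨G', hG⟩ := e.exists_eventuallyEq_push G (e.mem_target z)
    have h : ∀ᶠ w in 𝓝 z, B.bracketAt (e.push F) (e.push G) (e.toHomeo w) =
        B.bracket F' G' (e.toHomeo w) :=
      e.contMDiff.continuous.continuousAt.eventually (B.bracketAt_eventuallyEq hF.symm hG.symm)
    exact ((B.bracket F' G').contMDiff.comp e.contMDiff).contMDiffAt.congr_of_eventuallyEq h

variable [T2Space M]

theorem push_totalBracket (F G : i.SmoothTotal) {x : M} (hx : x ∈ e.toHomeo.target) :
    e.push (e.totalBracket B F G) =ᶠ[𝓝 x] B.bracketAt (e.push F) (e.push G) := by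
  filter_upwards [e.toHomeo.open_target.mem_nhds hx] with y hy
  exact congrArg (B.bracketAt (e.push F) (e.push G)) (e.toHomeo.right_inv hy)

theorem totalBracket_pullback (f g : C^∞⟮𝓡 m, M; ℝ⟯) :
    e.totalBracket B (e.pullback f) (e.pullback g) = e.pullback (B.bracket f g) := by
  ext z
  exact B.bracketAt_congr (e.push_pullback f (e.mem_target z)) (e.push_pullback g (e.mem_target z))

theorem totalBracket_congr {F F' G G' : i.SmoothTotal} {z : i.Total} (hF : F =ᶠ[𝓝 z] F')
    (hG : G =ᶠ[𝓝 z] G') : e.totalBracket B F G =ᶠ[𝓝 z] e.totalBracket B F' G' := by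
  filter_upwards [hF.eventuallyEq_nhds, hG.eventuallyEq_nhds] with w h1 h2
  exact B.bracketAt_congr (e.push_congr (e.mem_target w) (by rwa [e.symm_apply]))
    (e.push_congr (e.mem_target w) (by rwa [e.symm_apply]))

theorem totalBracket_self (F : i.SmoothTotal) : e.totalBracket B F F = 0 := by
  ext z
  exact B.alternating _ _

theorem totalBracket_add_left (F G H : i.SmoothTotal) :
    e.totalBracket B (F + G) H = e.totalBracket B F H + e.totalBracket B G H := by
  ext z
  have h : dAt (e.push (F + G)) (e.toHomeo z) = dAt (e.push F) (e.toHomeo z) +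
      dAt (e.push G) (e.toHomeo z) :=
    dAt_add (e.mdifferentiableAt_push F (e.mem_target z))
      (e.mdifferentiableAt_push G (e.mem_target z))
  change B.bracketAt _ _ _ = B.bracketAt _ _ _ + B.bracketAt _ _ _
  simp only [Bivector.bracketAt, h, map_add]

theorem totalBracket_add_right (F G H : i.SmoothTotal) :
    e.totalBracket B F (G + H) = e.totalBracket B F G + e.totalBracket B F H := by
  ext z
  have h : dAt (e.push (G + H)) (e.toHomeo z) = dAt (e.push G) (e.toHomeo z) +
      dAt (e.push H) (e.toHomeo z) :=
    dAt_add (e.mdifferentiableAt_push G (e.mem_target z))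
      (e.mdifferentiableAt_push H (e.mem_target z))
  change B.bracketAt _ _ _ = B.bracketAt _ _ _ + B.bracketAt _ _ _
  simp only [Bivector.bracketAt, h, add_apply]

theorem totalBracket_smul_left (c : ℝ) (F G : i.SmoothTotal) :
    e.totalBracket B (c • F) G = c • e.totalBracket B F G := by
  ext z
  have h : dAt (e.push (c • F)) (e.toHomeo z) = c • dAt (e.push F) (e.toHomeo z) :=
    dAt_const_mul c (e.mdifferentiableAt_push F (e.mem_target z))
  change B.bracketAt _ _ _ = c * B.bracketAt _ _ _
  simp only [Bivector.bracketAt, h, map_smul, smul_eq_mul]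

theorem totalBracket_smul_right (c : ℝ) (F G : i.SmoothTotal) :
    e.totalBracket B F (c • G) = c • e.totalBracket B F G := by
  ext z
  have h : dAt (e.push (c • G)) (e.toHomeo z) = c • dAt (e.push G) (e.toHomeo z) :=
    dAt_const_mul c (e.mdifferentiableAt_push G (e.mem_target z))
  change B.bracketAt _ _ _ = c * B.bracketAt _ _ _
  simp only [Bivector.bracketAt, h]
  rfl

theorem totalBracket_mul_right (F G H : i.SmoothTotal) :
    e.totalBracket B F (G * H) = e.totalBracket B F G * H + G * e.totalBracket B F H := by
  ext z
  have h : dAt (e.push (G * H)) (e.toHomeo z) =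
      e.push G (e.toHomeo z) • dAt (e.push H) (e.toHomeo z) +
        e.push H (e.toHomeo z) • dAt (e.push G) (e.toHomeo z) :=
    dAt_mul (e.mdifferentiableAt_push G (e.mem_target z))
      (e.mdifferentiableAt_push H (e.mem_target z))
  change B.bracketAt _ _ _ = B.bracketAt _ _ _ * H z + G z * B.bracketAt _ _ _
  simp only [Bivector.bracketAt, h, e.push_apply, add_apply]
  change G z * dAt (e.push H) (e.toHomeo z) (B.sharp (e.toHomeo z) (dAt (e.push F) (e.toHomeo z))) +
    H z * dAt (e.push G) (e.toHomeo z) (B.sharp (e.toHomeo z) (dAt (e.push F) (e.toHomeo z))) = _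
  ring

/-- The Jacobi identity on `M` concerns global smooth functions. At each point the three pushed
germs extend to such functions, and nested brackets depend only on germs. -/
theorem totalBracket_jacobi (B : PoissonStructure m M) (F G H : i.SmoothTotal) :
    e.totalBracket B.toBivector F (e.totalBracket B.toBivector G H) +
      e.totalBracket B.toBivector G (e.totalBracket B.toBivector H F) +
      e.totalBracket B.toBivector H (e.totalBracket B.toBivector F G) = 0 := by
  ext z
  have hz := e.mem_target z
  obtain ⟨F', hF⟩ := e.exists_eventuallyEq_push F hz
  obtain ⟨G', hG⟩ := e.exists_eventuallyEq_push G hz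
  obtain ⟨H', hH⟩ := e.exists_eventuallyEq_push H hz
  have key : ∀ (F G H : i.SmoothTotal) (F' G' H' : C^∞⟮𝓡 m, M; ℝ⟯),
      F' =ᶠ[𝓝 (e.toHomeo z)] e.push F → G' =ᶠ[𝓝 (e.toHomeo z)] e.push G →
      H' =ᶠ[𝓝 (e.toHomeo z)] e.push H →
      e.totalBracket B.toBivector F (e.totalBracket B.toBivector G H) z =
        B.bracket F' (B.bracket G' H') (e.toHomeo z) := fun F G H F' G' H' hF hG hH =>
    B.bracketAt_congr hF.symm ((e.push_totalBracket G H hz).trans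
      (B.bracketAt_eventuallyEq hG.symm hH.symm))
  change _ + _ + _ = (0 : ℝ)
  rw [key F G H F' G' H' hF hG hH, key G H F G' H' F' hG hH hF, key H F G H' F' G' hH hF hG]
  exact congrArg (fun f : C^∞⟮𝓡 m, M; ℝ⟯ => f (e.toHomeo z)) (B.jacobi F' G' H')

end ExponentialMap

end EmbeddedSubmanifold

/-! ### Linearization as a split algebra homomorphism -/

namespace EmbeddedSubmanifold

variable {k m : ℕ} {S M : Type*}
  [TopologicalSpace S] [ChartedSpace (EuclideanSpace ℝ (Fin k)) S] [IsManifold (𝓡 k) ∞ S]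
  [TopologicalSpace M] [ChartedSpace (EuclideanSpace ℝ (Fin m)) M] [IsManifold (𝓡 m) ∞ M]

variable {i : EmbeddedSubmanifold k m S M} {B : Bivector m M}

theorem affine_ext {φ ψ : i.Affine} (h₁ : ∀ q, φ.fst q = ψ.fst q)
    (h₂ : ∀ q v, φ.snd q v = ψ.snd q v) : φ = ψ := by
  refine TrivSqZeroExt.ext (ContMDiffMap.ext h₁) (ContMDiffSection.ext fun q => ?_)
  ext v
  exact h₂ q v

theorem aff_fst (F : i.SmoothTotal) (q : S) : (aff F).fst q = F (i.zero q) := rfl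

theorem aff_snd (F : i.SmoothTotal) (q : S) (v : i.Normal q) :
    (aff F).snd q v = mfderiv (totalModel k m) 𝓘(ℝ) F (i.zero q) (i.vert q v) := rfl

theorem contMDiff_eval (φ : i.Affine) : ContMDiff (totalModel k m) 𝓘(ℝ) ∞ (eval φ) := by
  have h1 : ContMDiff (totalModel k m) (𝓡 k) ∞ (fun z : i.Total => z.proj) :=
    Bundle.contMDiff_proj i.Normal
  have h2 : ContMDiff (totalModel k m)
      ((𝓡 k).prod 𝓘(ℝ, EuclideanSpace ℝ (Fin (m - k)) →L[ℝ] ℝ)) ∞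
      (fun z : i.Total => TotalSpace.mk' (EuclideanSpace ℝ (Fin (m - k)) →L[ℝ] ℝ)
        (E := fun q => i.Normal q →L[ℝ] ℝ) z.proj (φ.snd z.proj)) :=
    φ.snd.contMDiff.comp h1
  have h3 : ContMDiff (totalModel k m) (totalModel k m) ∞
      (fun z : i.Total => TotalSpace.mk' (EuclideanSpace ℝ (Fin (m - k)))
        (E := i.Normal) z.proj z.snd) := contMDiff_id
  have h4 := ContMDiff.clm_bundle_apply (E₂ := Bundle.Trivial S ℝ) h2 h3
  have h5 : ContMDiff (totalModel k m) 𝓘(ℝ) ∞ (fun z : i.Total => φ.snd z.proj z.snd) :=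
    fun z => (contMDiffAt_totalSpace.1 (h4 z)).2
  exact (φ.fst.contMDiff.comp h1).add h5

/-- A fiberwise affine function as a smooth function on the total space. -/
noncomputable def evalMap : i.Affine →ₗ[ℝ] i.SmoothTotal where
  toFun φ := ⟨eval φ, contMDiff_eval φ⟩
  map_add' φ ψ := by
    ext z
    change (φ + ψ).fst z.proj + (φ + ψ).snd z.proj z.snd = eval φ z + eval ψ z
    rw [TrivSqZeroExt.fst_add, TrivSqZeroExt.snd_add]
    change (φ.fst z.proj + ψ.fst z.proj) + (φ.snd z.proj z.snd + ψ.snd z.proj z.snd) = _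
    simp only [eval]
    ring
  map_smul' c φ := by
    ext z
    change (c • φ).fst z.proj + (c • φ).snd z.proj z.snd = c * eval φ z
    rw [TrivSqZeroExt.fst_smul, TrivSqZeroExt.snd_smul]
    change c * φ.fst z.proj + c * φ.snd z.proj z.snd = _
    simp only [eval]
    ring

/-- On each fiber the function is a constant plus a linear form, which is its own derivative. Thus
linearization is surjective, with the affine functions as a section. -/
theorem aff_evalMap (φ : i.Affine) : aff (evalMap φ) = φ := by
  refine affine_ext (fun q => ?_) (fun q v => ?_)
  · change φ.fst q + φ.snd q 0 = _
    rw [map_zero, add_zero]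
  · let t := trivializationAt (EuclideanSpace ℝ (Fin (m - k))) i.Normal q
    have hv : t.symmL ℝ q (t.continuousLinearMapAt ℝ q v) = v :=
      Trivialization.symmL_continuousLinearMapAt _
        (FiberBundle.mem_baseSet_trivializationAt' q) v
    have h : (fun w => evalMap φ (⟨q, t.symmL ℝ q w⟩ : i.Total)) =
        fun w => φ.fst q + (φ.snd q).comp (t.symmL ℝ q) w := rfl
    rw [aff_snd, ← hv, i.vert_symmL, h, fderiv_const_add, ContinuousLinearMap.fderiv, hv]
    exact congrArg (φ.snd q) hv

theorem mdifferentiableAt_smoothTotal (F : i.SmoothTotal) (z : i.Total) :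
    MDifferentiableAt (totalModel k m) 𝓘(ℝ) F z :=
  F.contMDiff.mdifferentiableAt (by simp)

variable (i) in
/-- The linearization map as a homomorphism of algebras. -/
noncomputable def affHom : i.SmoothTotal →ₐ[ℝ] i.Affine where
  toFun := aff
  map_one' := by
    refine affine_ext (fun q => rfl) (fun q v => ?_)
    rw [aff_snd]
    have h : mfderiv (totalModel k m) 𝓘(ℝ) (1 : i.SmoothTotal) (i.zero q) = 0 := mfderiv_const
    rw [h]
    rfl
  map_mul' F G := by
    refine affine_ext (fun q => rfl) (fun q v => ?_)
    rw [aff_snd]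
    exact DFunLike.congr_fun ((mdifferentiableAt_smoothTotal F (i.zero q)).hasMFDerivAt.mul
      (mdifferentiableAt_smoothTotal G (i.zero q)).hasMFDerivAt).mfderiv (i.vert q v)
  map_zero' := by
    refine affine_ext (fun q => rfl) (fun q v => ?_)
    rw [aff_snd]
    have h : mfderiv (totalModel k m) 𝓘(ℝ) (0 : i.SmoothTotal) (i.zero q) = 0 := mfderiv_const
    rw [h]
    rfl
  map_add' F G := by
    refine affine_ext (fun q => rfl) (fun q v => ?_)
    rw [aff_snd]
    exact DFunLike.congr_fun ((mdifferentiableAt_smoothTotal F (i.zero q)).hasMFDerivAt.add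
      (mdifferentiableAt_smoothTotal G (i.zero q)).hasMFDerivAt).mfderiv (i.vert q v)
  commutes' c := by
    refine affine_ext (fun q => rfl) (fun q v => ?_)
    rw [aff_snd]
    have h : mfderiv (totalModel k m) 𝓘(ℝ) (algebraMap ℝ i.SmoothTotal c) (i.zero q) = 0 :=
      mfderiv_const
    rw [h]
    rfl

theorem aff_zero : aff (0 : i.SmoothTotal) = 0 := i.affHom.map_zero'

theorem aff_add (F G : i.SmoothTotal) : aff (F + G) = aff F + aff G := i.affHom.map_add' F G

theorem aff_mul (F G : i.SmoothTotal) : aff (F * G) = aff F * aff G := i.affHom.map_mul' F G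

theorem aff_neg (F : i.SmoothTotal) : aff (-F) = -aff F :=
  eq_neg_of_add_eq_zero_left (by rw [← aff_add, neg_add_cancel, aff_zero])

theorem aff_sub (F G : i.SmoothTotal) : aff (F - G) = aff F - aff G := by
  rw [sub_eq_add_neg, aff_add, aff_neg, sub_eq_add_neg]

set_option synthInstance.maxHeartbeats 200000 in
theorem aff_smul (c : ℝ) (F : i.SmoothTotal) : aff (c • F) = c • aff F :=
  i.affHom.toLinearMap.map_smul c F

theorem aff_fst_congr {F G : i.SmoothTotal} {q : S} (h : F =ᶠ[𝓝 (i.zero q)] G) :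
    (aff F).fst q = (aff G).fst q := h.self_of_nhds

theorem aff_snd_congr {F G : i.SmoothTotal} {q : S} (h : F =ᶠ[𝓝 (i.zero q)] G) :
    (aff F).snd q = (aff G).snd q := by
  ext v
  rw [aff_snd, aff_snd, h.mfderiv_eq]
  rfl

/-! ### Descent of the transported bracket to the affine functions -/

namespace ExponentialMap

variable (e : i.ExponentialMap)

/-- The differential of the exponential map at the zero section, along the fibers. -/
noncomputable def normalLift (q : S) : i.Normal q →L[ℝ] TangentSpace (𝓡 m) (i.incl q) :=
  let D : TangentSpace (totalModel k m) (i.zero q) →L[ℝ] EuclideanSpace ℝ (Fin m) :=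
    mfderiv (totalModel k m) (𝓡 m) e.toHomeo (i.zero q)
  D.comp (i.vert q)

theorem nu_normalLift (q : S) (v : i.Normal q) : i.nu q (e.normalLift q v) = v := e.normal q v

/-- The normal lift is a right inverse of `ν_q`, whose kernel is `T_qS`. Hence `T_qS` and the lifted
fiber together span the tangent space of `M`. -/
theorem covector_eq_zero {q : S} {β : TangentSpace (𝓡 m) (i.incl q) →L[ℝ] ℝ}
    (h₁ : β.comp (i.diff q) = 0) (h₂ : ∀ v, β (e.normalLift q v) = 0) : β = 0 := by
  ext w
  obtain ⟨u, hu⟩ := exists_diff_of_nu_eq_zero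
    (v := w - e.normalLift q (i.nu q w)) (by rw [map_sub, e.nu_normalLift, sub_self])
  have h3 : β (i.diff q u) = 0 := DFunLike.congr_fun h₁ u
  rw [hu, map_sub, h₂, sub_zero] at h3
  exact h3

theorem mfderiv_eq_dAt_push (F : i.SmoothTotal) (q : S)
    (ξ : TangentSpace (totalModel k m) (i.zero q)) :
    mfderiv (totalModel k m) 𝓘(ℝ) F (i.zero q) ξ = dAt (e.push F) (i.incl q)
      (show EuclideanSpace ℝ (Fin m) from
        mfderiv (totalModel k m) (𝓡 m) e.toHomeo (i.zero q) ξ) := by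
  have h := mfderiv_comp (I'' := 𝓘(ℝ)) (g := e.push F) (i.zero q)
    (e.mdifferentiableAt_push F (e.mem_target _)) (e.contMDiff.mdifferentiableAt (by simp))
  have hF : e.push F ∘ e.toHomeo = F := funext fun z => e.push_apply F z
  rw [hF] at h
  -- The base points `e(0_q)` and `ι q` are equal but not by definition; the substitution is made on
  -- vectors of the common model space.
  have h2 : ∀ x : M, x = i.incl q → ∀ w : EuclideanSpace ℝ (Fin m),
      (dAt (d := m) (e.push F) x : EuclideanSpace ℝ (Fin m) → ℝ) w =
      (dAt (d := m) (e.push F) (i.incl q) : EuclideanSpace ℝ (Fin m) → ℝ) w := by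
    rintro _ rfl w; rfl
  exact (DFunLike.congr_fun h ξ).trans (h2 _ (e.map_zero q) _)

theorem aff_snd_eq (F : i.SmoothTotal) (q : S) (v : i.Normal q) :
    (aff F).snd q v = dAt (e.push F) (i.incl q) (e.normalLift q v) :=
  e.mfderiv_eq_dAt_push F q _

theorem dAt_push_comp_diff (F : i.SmoothTotal) (q : S) :
    (dAt (e.push F) (i.incl q)).comp (i.diff q) = dAt (aff F).fst q := by
  rw [← i.dAt_comp_incl (e.mdifferentiableAt_push F (e.incl_mem_target q))]
  exact congrArg (fun f => dAt (d := k) f q) (funext fun p => e.push_incl F p)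

/-- The linearization records the values on the zero section, hence the derivatives tangent to `S`,
and also the derivatives along the fibers. Together these are the whole differential. -/
theorem dAt_push_eq_zero {F : i.SmoothTotal} (hF : aff F = 0) (q : S) :
    dAt (d := m) (e.push F) (i.incl q) = 0 := by
  refine e.covector_eq_zero ?_ fun v => ?_
  · rw [e.dAt_push_comp_diff, hF]
    exact mfderiv_const
  · rw [← e.aff_snd_eq, hF]
    rfl

theorem isO2_iff_aff_eq_zero (e : i.ExponentialMap) (R : i.SmoothTotal) : IsO2 R ↔ aff R = 0 := by
  refine ⟨fun h => affine_ext (fun q => (h q).1) (fun q v => ?_), fun h q => ⟨?_, ?_⟩⟩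
  · rw [aff_snd, (h q).2]
    rfl
  · rw [← aff_fst, h]
    rfl
  · ext ξ
    rw [e.mfderiv_eq_dAt_push, e.dAt_push_eq_zero h]
    rfl

variable [T2Space M]

/-- The kernel of linearization is a Poisson ideal, which is what lets the bracket descend. The
value along `S` vanishes with the differential of `G`; the fiber derivative vanishes by tangency of
Hamiltonian vectors and symmetry of second derivatives. -/
theorem aff_totalBracket_eq_zero (h : i.IsPoisson B) (F : i.SmoothTotal) {G : i.SmoothTotal}
    (hG : aff G = 0) : aff (e.totalBracket B F G) = 0 := by
  refine affine_ext (fun q => ?_) (fun q v => ?_)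
  · have h1 : e.push (e.totalBracket B F G) (i.incl q) = B.bracketAt (e.push F) (e.push G) _ :=
      (e.push_totalBracket F G (e.incl_mem_target q)).self_of_nhds
    rw [aff_fst, ← e.push_incl, h1, Bivector.bracketAt, e.dAt_push_eq_zero hG]
    rfl
  · obtain ⟨F', hF'⟩ := e.exists_eventuallyEq_push F (e.incl_mem_target q)
    obtain ⟨G', hG'⟩ := e.exists_eventuallyEq_push G (e.incl_mem_target q)
    have h1 : e.push (e.totalBracket B F G) =ᶠ[𝓝 (i.incl q)] B.bracketAt F' G' :=
      (e.push_totalBracket F G (e.incl_mem_target q)).trans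
        (B.bracketAt_eventuallyEq hF'.symm hG'.symm)
    have h2 : ∀ᶠ p in 𝓝 q, dAt (d := m) G' (i.incl p) = 0 := by
      filter_upwards [i.contMDiff.continuous.continuousAt.eventually hG'.eventuallyEq_nhds]
        with p hp
      rw [dAt_congr hp, e.dAt_push_eq_zero hG]
    rw [e.aff_snd_eq, dAt_congr h1, h.dAt_bracket_eq_zero F' G' h2]
    rfl

theorem totalBracket_skew (F G : i.SmoothTotal) :
    e.totalBracket B F G = -e.totalBracket B G F := by
  have h := e.totalBracket_self (B := B) (F + G)
  rw [e.totalBracket_add_left, e.totalBracket_add_right, e.totalBracket_add_right,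
    e.totalBracket_self, e.totalBracket_self, zero_add, add_zero] at h
  exact eq_neg_of_add_eq_zero_left h

/-- Up to second order, the bracket only depends on the linearizations. -/
theorem aff_totalBracket_congr (h : i.IsPoisson B) {F F' G G' : i.SmoothTotal}
    (hF : aff F = aff F') (hG : aff G = aff G') :
    aff (e.totalBracket B F G) = aff (e.totalBracket B F' G') := by
  have right : ∀ {F G G' : i.SmoothTotal}, aff G = aff G' →
      aff (e.totalBracket B F G) = aff (e.totalBracket B F G') := by
    intro F G G' hG
    have h0 : aff (G - G') = 0 := by
      rw [aff_sub, hG, sub_self]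
    have h1 : G = G' + (G - G') := by abel
    rw [h1, e.totalBracket_add_right, aff_add, e.aff_totalBracket_eq_zero h F h0, add_zero]
  -- Skew-symmetry turns dependence on the left argument into dependence on the right one.
  rw [right hG, e.totalBracket_skew F, e.totalBracket_skew F', aff_neg, aff_neg, right hF]

/-- The linearized bracket on the fiberwise affine functions. -/
noncomputable def affineBracket (B : Bivector m M) : i.Affine →ₗ[ℝ] i.Affine →ₗ[ℝ] i.Affine :=
  LinearMap.mk₂ ℝ (fun φ ψ => aff (e.totalBracket B (evalMap φ) (evalMap ψ)))
    (fun φ φ' ψ => by rw [evalMap.map_add, e.totalBracket_add_left, aff_add])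
    (fun c φ ψ => by rw [evalMap.map_smul, e.totalBracket_smul_left, aff_smul])
    (fun φ ψ ψ' => by rw [evalMap.map_add, e.totalBracket_add_right, aff_add])
    (fun c φ ψ => by rw [evalMap.map_smul, e.totalBracket_smul_right, aff_smul])

theorem affineBracket_apply (φ ψ : i.Affine) :
    e.affineBracket B φ ψ = aff (e.totalBracket B (evalMap φ) (evalMap ψ)) := rfl

/-- Linearization respects brackets on all of `C^∞(E)`, so the Jacobi and Leibniz identities pass to
the affine functions. -/
theorem affineBracket_aff (h : i.IsPoisson B) (F G : i.SmoothTotal) :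
    e.affineBracket B (aff F) (aff G) = aff (e.totalBracket B F G) :=
  e.aff_totalBracket_congr h (aff_evalMap _) (aff_evalMap _)

theorem push_bracket_eventuallyEq {F G : i.SmoothTotal} {f g : C^∞⟮𝓡 m, M; ℝ⟯} {x : M}
    (hx : x ∈ e.toHomeo.target) (hf : f =ᶠ[𝓝 x] e.push F) (hg : g =ᶠ[𝓝 x] e.push G) :
    e.push (e.totalBracket B F G) =ᶠ[𝓝 x] B.bracket f g :=
  (e.push_totalBracket F G hx).trans (B.bracketAt_eventuallyEq hf.symm hg.symm)

theorem fst_aff_totalBracket (h : i.IsPoisson B) (F G : i.SmoothTotal) (q : S) :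
    (aff (e.totalBracket B F G)).fst q = h.bracketAt (aff F).fst (aff G).fst q := by
  have h1 : e.push (e.totalBracket B F G) (i.incl q) = B.bracketAt (e.push F) (e.push G) _ :=
    (e.push_totalBracket F G (e.incl_mem_target q)).self_of_nhds
  rw [aff_fst, ← e.push_incl, h1,
    h.bracketAt_incl (e.mdifferentiableAt_push F (e.incl_mem_target q))
      (e.mdifferentiableAt_push G (e.incl_mem_target q))]
  exact congrArg₂ (fun f g => h.bracketAt f g q) (funext fun p => e.push_incl F p)
    (funext fun p => e.push_incl G p)

/-- A function vanishing on `S` has a conormal differential, determined by its fiber part. Both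
sides agree on `T_qS` and on the lifted fiber. -/
theorem dAt_push_of_fst_eq_zero {F : i.SmoothTotal} (hF : (aff F).fst = 0) (q : S) :
    dAt (d := m) (e.push F) (i.incl q) = ((aff F).snd q).comp (i.nu q) := by
  rw [← sub_eq_zero]
  refine e.covector_eq_zero ?_ fun v => ?_
  · ext u
    have h1 : (dAt (e.push F) (i.incl q)).comp (i.diff q) u = 0 := by
      rw [e.dAt_push_comp_diff, hF]
      exact DFunLike.congr_fun (mfderiv_const (I := 𝓡 k) (I' := 𝓘(ℝ)) (c := (0 : ℝ)) (x := q)) u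
    have h2 : ((aff F).snd q) (i.nu q (i.diff q u)) = 0 := by
      rw [i.nu_diff, _root_.map_zero]
    exact (congrArg₂ (· - ·) h1 h2).trans (sub_zero 0)
  · have h2 : ((aff F).snd q) (i.nu q (e.normalLift q v)) = (aff F).snd q v := by
      rw [e.nu_normalLift]
    exact (congrArg₂ (· - ·) (e.aff_snd_eq F q v).symm h2).trans (sub_self _)

theorem fst_aff_totalBracket_eq_zero (h : i.IsPoisson B) {F G : i.SmoothTotal}
    (hF : (aff F).fst = 0) : (aff (e.totalBracket B F G)).fst = 0 := by
  refine ContMDiffMap.ext fun q => ?_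
  rw [e.fst_aff_totalBracket h, hF, IsPoisson.bracketAt]
  have : dAt (d := k) (0 : C^∞⟮𝓡 k, S; ℝ⟯) q = 0 := mfderiv_const
  rw [this, _root_.map_zero, _root_.map_zero]
  rfl

/-- Condition (b) in terms of functions. The given forms agree at `ι q` with the differentials of
the pushed functions, and for conormal forms agreement at this single point fixes the bracket there.
-/
theorem isConormalBracket_snd (h : i.IsPoisson B) {F G : i.SmoothTotal}
    (hF : (aff F).fst = 0) (hG : (aff G).fst = 0) :
    i.IsConormalBracket B (aff F).snd (aff G).snd (aff (e.totalBracket B F G)).snd := by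
  intro q α β hα hβ
  obtain ⟨f, hf⟩ := e.exists_eventuallyEq_push F (e.incl_mem_target q)
  obtain ⟨g, hg⟩ := e.exists_eventuallyEq_push G (e.incl_mem_target q)
  have hcon : ∀ {H : i.SmoothTotal}, (aff H).fst = 0 →
      (dAt (e.push H) (i.incl q)).comp (i.diff q) = 0 := fun hH => by
    rw [e.dAt_push_comp_diff, hH]
    exact mfderiv_const
  rw [← e.dAt_push_of_fst_eq_zero (e.fst_aff_totalBracket_eq_zero h hF),
    h.formBracketAt_eq_dAt (f := f) (g := g)
      (by rw [hα.self_of_nhds, dAt_congr hf, e.dAt_push_of_fst_eq_zero hF])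
      (by rw [hβ.self_of_nhds, dAt_congr hg, e.dAt_push_of_fst_eq_zero hG])
      (by rw [dAt_congr hf, hcon hF]) (by rw [dAt_congr hg, hcon hG])]
  exact dAt_congr (e.push_bracket_eventuallyEq (e.incl_mem_target q) hf hg)

/-- The linearization of the Poisson structure along `S`. -/
noncomputable def infinitesimalPoissonAlgebra (B : PoissonStructure m M)
    (h : i.IsPoisson B.toBivector) : InfinitesimalPoissonAlgebra h where
  bracket := e.affineBracket B.toBivector
  bracket_self φ := by
    rw [affineBracket_apply, e.totalBracket_self, aff_zero]
  jacobi φ₁ φ₂ φ₃ := by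
    have key := congrArg aff
      (e.totalBracket_jacobi B (evalMap φ₁) (evalMap φ₂) (evalMap φ₃))
    simp only [aff_add, aff_zero, ← e.affineBracket_aff h, aff_evalMap] at key
    exact key
  leibniz φ₁ φ₂ φ₃ := by
    have key := congrArg aff
      (e.totalBracket_mul_right (B := B.toBivector) (evalMap φ₁) (evalMap φ₂) (evalMap φ₃))
    simp only [aff_add, ← e.affineBracket_aff h, aff_mul, aff_evalMap] at key
    exact key
  fst_bracket φ₁ φ₂ q := by
    rw [affineBracket_apply, e.fst_aff_totalBracket h, aff_evalMap, aff_evalMap]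
  bracket_inr η₁ η₂ := by
    have h1 : ∀ η : i.ConormalSection, aff (evalMap (TrivSqZeroExt.inr η)) = TrivSqZeroExt.inr η :=
      fun η => aff_evalMap _
    have hf : ∀ η : i.ConormalSection, (aff (evalMap (TrivSqZeroExt.inr η))).fst = 0 :=
      fun η => by rw [h1, TrivSqZeroExt.fst_inr]
    have key := e.isConormalBracket_snd h (hf η₁) (hf η₂)
    rw [h1, h1, TrivSqZeroExt.snd_inr, TrivSqZeroExt.snd_inr] at key
    refine ⟨_, key, TrivSqZeroExt.ext ?_ rfl⟩
    exact e.fst_aff_totalBracket_eq_zero h (hf η₁)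

/-- Linearizing `(*)` kills the remainder and fixes the affine right-hand side. Conversely, a
function minus its linearization is `O₂`. -/
theorem isFirstOrderApproximation_iff {B : Bivector m M} {h : i.IsPoisson B}
    (P : InfinitesimalPoissonAlgebra h) :
    IsFirstOrderApproximation e P ↔ P.bracket = e.affineBracket B := by
  constructor
  · intro hP
    refine LinearMap.ext₂ fun φ ψ => ?_
    obtain ⟨R, hR, hz⟩ := hP φ ψ
    have : e.totalBracket B (evalMap φ) (evalMap ψ) = evalMap (P.bracket φ ψ) + R :=
      ContMDiffMap.ext hz
    rw [affineBracket_apply, this, aff_add, aff_evalMap, (e.isO2_iff_aff_eq_zero R).1 hR, add_zero]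
  · intro hP φ ψ
    refine ⟨e.totalBracket B (evalMap φ) (evalMap ψ) - evalMap (P.bracket φ ψ), ?_, fun z => ?_⟩
    · rw [e.isO2_iff_aff_eq_zero, hP, aff_sub, aff_evalMap, affineBracket_apply, sub_self]
    · exact (add_sub_cancel _ _).symm

/-- The pull-back as a homomorphism of algebras. -/
noncomputable def pullbackHom : C^∞⟮𝓡 m, M; ℝ⟯ →ₐ[ℝ] i.SmoothTotal where
  toFun := e.pullback
  map_one' := rfl
  map_mul' _ _ := rfl
  map_zero' := rfl
  map_add' _ _ := rfl
  commutes' _ := rfl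

theorem affIsPoissonHom_iff {B : Bivector m M} {h : i.IsPoisson B}
    (P : InfinitesimalPoissonAlgebra h) :
    AffIsPoissonHom e P ↔ ∀ f g : C^∞⟮𝓡 m, M; ℝ⟯,
      aff (e.totalBracket B (e.pullback f) (e.pullback g)) =
        P.bracket (aff (e.pullback f)) (aff (e.pullback g)) := by
  constructor
  · rintro ⟨Φ, hΦ, hP⟩ f g
    rw [e.totalBracket_pullback, ← hΦ, ← hΦ, ← hΦ, hP]
  · intro hP
    refine ⟨i.affHom.comp e.pullbackHom, fun _ => rfl, fun f g => ?_⟩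
    refine Eq.trans ?_ (hP f g)
    rw [e.totalBracket_pullback]
    rfl

end ExponentialMap

/-! ### Locality of infinitesimal Poisson brackets -/

namespace InfinitesimalPoissonAlgebra

variable {h : i.IsPoisson B} (P : InfinitesimalPoissonAlgebra h)

set_option synthInstance.maxHeartbeats 200000 in
theorem bracket_skew (φ ψ : i.Affine) : P.bracket φ ψ = -P.bracket ψ φ := by
  have h := P.bracket_self (φ + ψ)
  rw [P.bracket.map_add, LinearMap.add_apply, (P.bracket φ).map_add, (P.bracket ψ).map_add,
    P.bracket_self, P.bracket_self, zero_add, add_zero] at h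
  exact eq_neg_of_add_eq_zero_left h

/-- If a bump function `ρ` at `q` is supported where `φ` vanishes, then `ρφ = 0`. The Leibniz rule
expands `0 = {ψ, ρφ}` as `{ψ, ρ}φ + ρ{ψ, φ}`, and at `q` the first term vanishes while `ρ = 1`. -/
theorem bracket_right_local [T2Space M] (ψ : i.Affine) {φ : i.Affine} {q : S}
    (hφ : ∀ᶠ p in 𝓝 q, φ.fst p = 0 ∧ φ.snd p = 0) :
    (P.bracket ψ φ).fst q = 0 ∧ (P.bracket ψ φ).snd q = 0 := by
  have : T2Space S := i.isSmoothEmbedding.isEmbedding.t2Space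
  obtain ⟨ρ, -, hρ⟩ := (SmoothBumpFunction.nhds_basis_tsupport (I := 𝓡 k) q).mem_iff.1 hφ
  let r : C^∞⟮𝓡 k, S; ℝ⟯ := ⟨ρ, ρ.contMDiff⟩
  have hr : r q = 1 := ρ.eq_one
  have hmul : (TrivSqZeroExt.inl r : i.Affine) * φ = 0 := by
    have hp : ∀ p, ρ p = 0 ∨ φ.fst p = 0 ∧ φ.snd p = 0 := fun p => by
      by_cases hp : p ∈ tsupport ρ
      · exact Or.inr (hρ hp)
      · exact Or.inl (image_eq_zero_of_notMem_tsupport hp)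
    refine affine_ext (fun p => ?_) (fun p v => ?_)
    · change ρ p * φ.fst p = 0
      rcases hp p with h | h <;> simp [h]
    · rw [TrivSqZeroExt.snd_mul, TrivSqZeroExt.fst_inl, TrivSqZeroExt.snd_inl, smul_zero, add_zero]
      change ρ p • φ.snd p v = 0
      rcases hp p with h | h <;> simp [h]
  have hl := P.leibniz ψ (TrivSqZeroExt.inl r) φ
  rw [hmul, (P.bracket ψ).map_zero] at hl
  obtain ⟨h1, h2⟩ := hφ.self_of_nhds
  have e1 := congrArg (fun χ : i.Affine => χ.fst q) hl
  have e2 := congrArg (fun χ : i.Affine => χ.snd q) hl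
  constructor
  · change (0 : ℝ) = (P.bracket ψ (TrivSqZeroExt.inl r)).fst q * φ.fst q +
      r q * (P.bracket ψ φ).fst q at e1
    rw [h1, hr] at e1
    linarith
  · simp only [TrivSqZeroExt.snd_add, TrivSqZeroExt.snd_mul, TrivSqZeroExt.fst_inl,
      TrivSqZeroExt.snd_inl, smul_zero, add_zero] at e2
    change 0 = (P.bracket ψ (TrivSqZeroExt.inl r)).fst q • φ.snd q +
      φ.fst q • (P.bracket ψ (TrivSqZeroExt.inl r)).snd q +
        r q • (P.bracket ψ φ).snd q at e2
    rw [h1, h2, hr, smul_zero, zero_smul, one_smul, zero_add, zero_add] at e2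
    exact e2.symm

/-- The bracket is local. -/
theorem bracket_congr [T2Space M] {φ φ' ψ ψ' : i.Affine} {q : S}
    (hφ : ∀ᶠ p in 𝓝 q, φ.fst p = φ'.fst p ∧ φ.snd p = φ'.snd p)
    (hψ : ∀ᶠ p in 𝓝 q, ψ.fst p = ψ'.fst p ∧ ψ.snd p = ψ'.snd p) :
    (P.bracket φ ψ).fst q = (P.bracket φ' ψ').fst q ∧
      (P.bracket φ ψ).snd q = (P.bracket φ' ψ').snd q := by
  have right : ∀ {φ ψ ψ' : i.Affine},
      (∀ᶠ p in 𝓝 q, ψ.fst p = ψ'.fst p ∧ ψ.snd p = ψ'.snd p) →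
      (P.bracket φ ψ).fst q = (P.bracket φ ψ').fst q ∧
        (P.bracket φ ψ).snd q = (P.bracket φ ψ').snd q := by
    intro φ ψ ψ' hψ
    have h := P.bracket_right_local φ (φ := ψ - ψ') (q := q)
      (hψ.mono fun p hp => ⟨sub_eq_zero.2 hp.1, sub_eq_zero.2 hp.2⟩)
    rw [(P.bracket φ).map_sub] at h
    exact ⟨sub_eq_zero.1 h.1, sub_eq_zero.1 h.2⟩
  obtain ⟨a1, a2⟩ := right (φ := φ) hψ
  obtain ⟨b1, b2⟩ := right (φ := ψ') hφ
  rw [a1, a2, P.bracket_skew φ, P.bracket_skew φ']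
  exact ⟨congrArg Neg.neg b1, congrArg Neg.neg b2⟩

end InfinitesimalPoissonAlgebra

/-! ### The homomorphism criterion and the theorem -/

theorem ExponentialMap.affIsPoissonHom_iff_bracket_eq [T2Space M] (e : i.ExponentialMap)
    {h : i.IsPoisson B} (P : InfinitesimalPoissonAlgebra h) :
    AffIsPoissonHom e P ↔ P.bracket = e.affineBracket B := by
  rw [e.affIsPoissonHom_iff]
  refine ⟨fun hP => LinearMap.ext₂ fun φ ψ => ?_, fun hP f g => ?_⟩
  · have key : ∀ q, (P.bracket φ ψ).fst q = (e.affineBracket B φ ψ).fst q ∧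
        (P.bracket φ ψ).snd q = (e.affineBracket B φ ψ).snd q := by
      intro q
      -- An affine function need not be a global pull-back from `M`, since its push-forward may not
      -- extend beyond the image of `e`. Agreement near `0_q` is available and, by locality of both
      -- brackets, enough.
      have ext : ∀ φ : i.Affine, ∃ f : C^∞⟮𝓡 m, M; ℝ⟯,
          e.pullback f =ᶠ[𝓝 (i.zero q)] evalMap φ := fun φ => by
        obtain ⟨f, hf⟩ := e.exists_eventuallyEq_push (evalMap φ) (e.mem_target (i.zero q))
        refine ⟨f, ?_⟩
        filter_upwards [e.contMDiff.continuous.continuousAt.eventually hf] with z hz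
        exact hz.trans (e.push_apply _ z)
      have near : ∀ {φ : i.Affine} {F : i.SmoothTotal}, F =ᶠ[𝓝 (i.zero q)] evalMap φ →
          ∀ᶠ p in 𝓝 q, φ.fst p = (aff F).fst p ∧ φ.snd p = (aff F).snd p := fun {φ F} hF => by
        have hc : Continuous i.zero :=
          (contMDiff_zeroSection (n := ∞) (IB := 𝓡 k) ℝ i.Normal).continuous
        filter_upwards [hc.continuousAt.eventually hF.eventuallyEq_nhds] with p hp
        rw [aff_fst_congr hp, aff_snd_congr hp, aff_evalMap]
        exact ⟨rfl, rfl⟩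
      obtain ⟨f, hf⟩ := ext φ
      obtain ⟨g, hg⟩ := ext ψ
      obtain ⟨h1, h2⟩ := P.bracket_congr (near hf) (near hg)
      have h3 := e.totalBracket_congr (B := B) hf hg
      rw [h1, h2, ← hP, e.affineBracket_apply, aff_fst_congr h3, aff_snd_congr h3]
      exact ⟨rfl, rfl⟩
    exact affine_ext (fun q => (key q).1) (fun q v => by rw [(key q).2])
  · rw [hP, e.affineBracket_aff h]

end EmbeddedSubmanifold

open EmbeddedSubmanifold
theorem theorem3p2 {k m : ℕ} {S M : Type*}
    [TopologicalSpace S] [ChartedSpace (EuclideanSpace ℝ (Fin k)) S] [IsManifold (𝓡 k) ∞ S]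
    [TopologicalSpace M] [ChartedSpace (EuclideanSpace ℝ (Fin m)) M] [IsManifold (𝓡 m) ∞ M]
    [T2Space M] [SecondCountableTopology M]
    (B : PoissonStructure m M) (i : EmbeddedSubmanifold k m S M)
    (hS : i.IsPoisson B.toBivector) (e : i.ExponentialMap) :
    (∃ P : InfinitesimalPoissonAlgebra hS, IsFirstOrderApproximation e P) ∧
    ∀ P : InfinitesimalPoissonAlgebra hS,
      IsFirstOrderApproximation e P ↔ AffIsPoissonHom e P := by
  refine ⟨⟨e.infinitesimalPoissonAlgebra B hS, ?_⟩, fun P => ?_⟩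
  · rw [e.isFirstOrderApproximation_iff]
    rfl
  · rw [e.isFirstOrderApproximation_iff, e.affIsPoissonHom_iff_bracket_eq]
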